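/- For a graph $G$ and a graph $J$, let $N(G,J)$ be the number of copies of $J$ in $G$, that is, of (unlabeled, not necessarily induced) subgraphs of $G$ isomorphic to $J$. For an integer $n\ge 0$ and $p\in[0,1]$ let $G_{n,p}$ be the random graph with vertex set $\{1,\dots,n\}$ that contains each edge of $K_n$ with probability $p$, independently, and put $\mathbb{E}_pX_J=\mathbb{E}\,N(G_{n,p},J)$. For $q\in[0,1]$, a finite graph $H$ is called $q$-sparse if $\mathbb{E}_qX_I\ge 1$ for every subgraph $I\subseteq H$. Write $\log=\log_2$ (with the convention $\log 0=0$). **Theorem 1.8.** There is an absolute constant $K>0$ such that the following holds for every integer $n\ge 0$, all $p,q\in[0,1]$ and every finite graph $H$. If $H$ is $q$-sparse and $p=Kq\log^2 n$, then $$N(H,F)<\mathbb{E}_pX_F\qquad\text{for every subgraph } F\subseteq H \text{ with at least one edge},\tag{$*$}$$ and $N(H,F)\le\mathbb{E}_pX_F$ for every subgraph $F\subseteq H$ without edges. Furthermore, there is an absolute constant $\alpha>0$ such that, for every integer $n\ge1$, all $p,q\in[0,1]$ and every finite graph $H$, the same conclusion (that is, $(*)$ together with the non-strict inequality for edgeless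 $F\subseteq H$) holds if $H$ is $q$-sparse and $q=\alpha p<1/(3n)$. -/

import Mathlib

open MeasureTheory

/-- `expectedCopies n p J` is the expectation of the number of (unlabelled) copies of `J` in the
binomial random graph on `n` labelled vertices with edge probability `p`. -/
noncomputable def expectedCopies (n : ℕ) (p : unitInterval) {W : Type*} (J : SimpleGraph W) : ℝ :=
  ∫ G : SimpleGraph (Fin n), (G.copyCount J : ℝ) ∂(SimpleGraph.binomialRandom (Fin n) p)

/-- `J` is `q`-sparse (relative to `n`): every subgraph of `J`, induced or not, has on average at
least one copy in the binomial random graph with parameters `n` and `q`. -/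
def IsSparse (n : ℕ) (q : unitInterval) {V : Type*} (J : SimpleGraph V) : Prop :=
  ∀ I : J.Subgraph, 1 ≤ expectedCopies n q I.coe

/-!
Since `N(H, F) · |Aut F|` counts the labelled copies of `F`, it is enough to compare labelled copies
of `F` in `H` with those in the complete graph on `n` vertices. Sparsity, applied to a subgraph `I`,
says that `|Aut I| ≤ n ^ |I| * q ^ e(I)`; it turns configurations of `H` with many symmetries into
upper bounds. The main instance is a *petal graph*, `m` disjoint extensions of one common base: its
`m!` automorphisms bound `m`.

For `p = K q log² n`, a copy of `F` is built block by block, in an order of least weight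
`n ^ v * (2q) ^ e`. Where the expected number of extensions exceeds one, a maximal family of
disjoint extensions forms a petal graph, which bounds the number of all extensions by the expected
one up to a power of `log n`. Where it does not, the vertices lie in a closed set that spans few
edges, so the extensions are counted by choosing the image of these edges and tracing each
connected piece. Vertices of degree larger than `log n` cost no more than a factor `4` per edge.

For `n q < 1 / 3`, sparsity makes `H` a forest. A tree `T` is extended to its whole component, which
is a tree with `k` more vertices for some `k`. There are at most `(|T| + k) ^ k` such trees, each
is isomorphic to few components because equal components can be permuted, and the sum over `k` is a
geometric series of ratio `e n q < 10 / 11`.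
-/

open Finset

section CopyCounts

variable {V W : Type*}

open scoped Classical in
lemma labelledCopyCount_eq_card_filter [Fintype V] [Fintype W] (G : SimpleGraph V)
    (J : SimpleGraph W) :
    G.labelledCopyCount J =
      #{f : W → V | Function.Injective f ∧ ∀ u v, J.Adj u v → G.Adj (f u) (f v)} := by
  rw [SimpleGraph.labelledCopyCount, ← Fintype.card_subtype]
  exact Fintype.card_congr
    { toFun := fun f => ⟨f, f.injective, fun _ _ => f.toHom.map_adj⟩
      invFun := fun f => ⟨⟨f.1, f.2.2 _ _⟩, f.2.1⟩ }

lemma toSubgraph_comp_iso {G : SimpleGraph V} {J : SimpleGraph W} (f : J.Copy G) (σ : J ≃g J) :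
    (f.comp σ.toCopy).toSubgraph = f.toSubgraph :=
  (SimpleGraph.Subgraph.map_comp _ _ _).trans <| by rw [SimpleGraph.Subgraph.map_iso_top]

lemma exists_comp_iso_eq {G : SimpleGraph V} {J : SimpleGraph W} {f f' : J.Copy G}
    (h : f'.toSubgraph = f.toSubgraph) : ∃ σ : J ≃g J, f.comp σ.toCopy = f' := by
  obtain ⟨e, he⟩ : ∃ e : J ≃g f.toSubgraph.coe, ∀ a, (e a : V) = f' a := by
    rw [← h]
    exact ⟨f'.isoToSubgraph, fun _ => rfl⟩
  refine ⟨e.trans f.isoToSubgraph.symm, SimpleGraph.Copy.ext fun a => ?_⟩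
  exact (congrArg Subtype.val (f.isoToSubgraph.apply_symm_apply (e a))).trans (he a)

lemma labelledCopyCount_eq_copyCount_mul_card_aut [Fintype V] [Fintype W] (G : SimpleGraph V)
    (J : SimpleGraph W) : G.labelledCopyCount J = G.copyCount J * Nat.card (J ≃g J) := by
  classical
  rw [SimpleGraph.copyCount_eq_card_image_copyToSubgraph, SimpleGraph.labelledCopyCount,
    ← card_univ, card_eq_sum_card_image SimpleGraph.Copy.toSubgraph]
  refine sum_const_nat fun G' hG' => ?_
  obtain ⟨f, -, rfl⟩ := mem_image.1 hG'
  rw [← Fintype.card_subtype, ← Nat.card_eq_fintype_card]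
  refine (Nat.card_congr <| Equiv.ofBijective
    (fun σ : J ≃g J => ⟨f.comp σ.toCopy, toSubgraph_comp_iso f σ⟩) ⟨fun σ τ h => ?_, ?_⟩).symm
  · ext a
    exact f.injective (DFunLike.congr_fun (congrArg Subtype.val h) a)
  · rintro ⟨f', hf'⟩
    exact (exists_comp_iso_eq hf').imp fun _ => Subtype.ext

end CopyCounts

section Expectation

variable {V W : Type*}

lemma setBernoulli_superset {ι : Type*} {u : Set ι} (p : unitInterval) {D : Finset ι}
    (hD : (D : Set ι) ⊆ u) :
    ProbabilityTheory.setBernoulli u p {s | (D : Set ι) ⊆ s} =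
      (unitInterval.toNNReal p : ENNReal) ^ #D := by
  have hpi : (fun f : ι → Prop => {i | f i}) ⁻¹' {s | (D : Set ι) ⊆ s} =
      Set.pi (D : Set ι) fun _ => {True} := by
    ext f
    simp [Set.subset_def, Set.mem_pi]
  rw [ProbabilityTheory.setBernoulli_apply', hpi, Measure.infinitePi_pi _ (by measurability),
    ← prod_const]
  exact prod_congr rfl fun i hi => by simp [hD hi]

lemma measurableSet_superset [Countable V] (D : Finset (Sym2 V)) :
    MeasurableSet {G : SimpleGraph V | (D : Set (Sym2 V)) ⊆ G.edgeSet} := by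
  have hD : {G : SimpleGraph V | (D : Set (Sym2 V)) ⊆ G.edgeSet} =
      ⋂ e ∈ D, SimpleGraph.edgeSet ⁻¹' {s | e ∈ s} := by
    ext
    simp [Set.subset_def]
  rw [hD]
  exact measurableSet_biInter D fun e _ =>
    SimpleGraph.measurable_edgeSet (measurableSet_setOfPred.2 (measurable_set_mem e))

lemma binomialRandom_superset [Countable V] (p : unitInterval) {D : Finset (Sym2 V)}
    (hD : ∀ e ∈ D, ¬ e.IsDiag) :
    SimpleGraph.binomialRandom V p {G | (D : Set (Sym2 V)) ⊆ G.edgeSet} =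
      (unitInterval.toNNReal p : ENNReal) ^ #D := by
  rw [SimpleGraph.binomialRandom_eq_map,
    Measure.map_apply (by fun_prop) (measurableSet_superset D),
    ← setBernoulli_superset (u := Sym2.diagSetᶜ) p fun e he => by simpa using hD e he]
  congr 1
  ext s
  simp only [Set.mem_preimage, Set.mem_ofPred_eq, SimpleGraph.edgeSet_fromEdgeSet]
  exact ⟨fun h e he => (h he).1, fun h e he => ⟨h he, by simpa using hD e he⟩⟩

open scoped Classical in
lemma labelledCopyCount_eq_sum_indicator [Fintype V] [Fintype W] (G : SimpleGraph V)
    (J : SimpleGraph W) :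
    (G.labelledCopyCount J : ℝ) = ∑ f : W ↪ V,
      {G : SimpleGraph V | ((J.edgeFinset.map f.sym2Map : Finset (Sym2 V)) : Set (Sym2 V)) ⊆
        G.edgeSet}.indicator (fun _ => (1 : ℝ)) G := by
  have hmem (f : W ↪ V) : ((J.edgeFinset.map f.sym2Map : Finset (Sym2 V)) : Set (Sym2 V)) ⊆
      G.edgeSet ↔ ∀ u v, J.Adj u v → G.Adj (f u) (f v) := by
    rw [coe_map, Set.image_subset_iff, SimpleGraph.coe_edgeFinset]
    exact ⟨fun h u v => @h s(u, v), fun h e => e.ind h⟩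
  simp only [Set.indicator_apply, Set.mem_ofPred_eq, hmem]
  rw [sum_boole, labelledCopyCount_eq_card_filter, ← Fintype.card_subtype, ← Fintype.card_subtype]
  exact congrArg _ <| Fintype.card_congr
    { toFun := fun f => ⟨⟨f.1, f.2.1⟩, f.2.2⟩
      invFun := fun f => ⟨f.1, f.1.injective, f.2⟩ }

lemma integral_labelledCopyCount (n : ℕ) (p : unitInterval) [Fintype W] (J : SimpleGraph W) :
    ∫ G : SimpleGraph (Fin n), (G.labelledCopyCount J : ℝ)
      ∂(SimpleGraph.binomialRandom (Fin n) p) =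
      (n.descFactorial (Fintype.card W) : ℝ) * (p : ℝ) ^ Nat.card J.edgeSet := by
  classical
  have hdiag (f : W ↪ Fin n) : ∀ e ∈ J.edgeFinset.map f.sym2Map, ¬ e.IsDiag := by
    intro e he
    obtain ⟨e', he', rfl⟩ := mem_map.1 he
    induction e' with | _ u v =>
    simpa using J.ne_of_adj (SimpleGraph.mem_edgeFinset.1 he')
  simp only [labelledCopyCount_eq_sum_indicator]
  rw [integral_finsetSum _ fun f _ =>
    (integrable_const (1 : ℝ)).indicator (measurableSet_superset _)]
  simp only [integral_indicator_const _ (measurableSet_superset _), measureReal_def,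
    binomialRandom_superset p (hdiag _), card_map, SimpleGraph.edgeFinset_card,
    ← Nat.card_eq_fintype_card]
  simp [Fintype.card_embedding_eq]

lemma expectedCopies_mul_card_aut (n : ℕ) (p : unitInterval) [Fintype W] (J : SimpleGraph W) :
    expectedCopies n p J * Nat.card (J ≃g J) =
      (n.descFactorial (Fintype.card W) : ℝ) * (p : ℝ) ^ Nat.card J.edgeSet := by
  rw [← integral_labelledCopyCount, expectedCopies, ← integral_mul_const]
  simp only [labelledCopyCount_eq_copyCount_mul_card_aut, Nat.cast_mul]

lemma expectedCopies_congr (n : ℕ) (p : unitInterval) {W' : Type*} {J : SimpleGraph W}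
    {J' : SimpleGraph W'} (e : J ≃g J') : expectedCopies n p J = expectedCopies n p J' := by
  have hcount (G : SimpleGraph (Fin n)) : G.copyCount J = G.copyCount J' := by
    classical
    refine congrArg card (filter_congr fun _ _ => ?_)
    exact ⟨fun ⟨f⟩ => ⟨e.symm.trans f⟩, fun ⟨f⟩ => ⟨e.trans f⟩⟩
  simp only [expectedCopies, hcount]

lemma card_aut_pos [Finite W] (J : SimpleGraph W) : 0 < Nat.card (J ≃g J) :=
  have : Finite (J ≃g J) := DFunLike.finite _
  have : Nonempty (J ≃g J) := ⟨SimpleGraph.Iso.refl⟩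
  Nat.card_pos

lemma copyCount_le_expectedCopies {n : ℕ} {p : unitInterval} [Fintype V] [Fintype W]
    {H : SimpleGraph V} {J : SimpleGraph W}
    (h : (H.labelledCopyCount J : ℝ) ≤
      (n.descFactorial (Fintype.card W) : ℝ) * (p : ℝ) ^ Nat.card J.edgeSet) :
    (H.copyCount J : ℝ) ≤ expectedCopies n p J := by
  rw [← expectedCopies_mul_card_aut, labelledCopyCount_eq_copyCount_mul_card_aut, Nat.cast_mul] at h
  exact le_of_mul_le_mul_right h (by exact_mod_cast card_aut_pos J)

lemma copyCount_lt_expectedCopies {n : ℕ} {p : unitInterval} [Fintype V] [Fintype W]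
    {H : SimpleGraph V} {J : SimpleGraph W}
    (h : (H.labelledCopyCount J : ℝ) <
      (n.descFactorial (Fintype.card W) : ℝ) * (p : ℝ) ^ Nat.card J.edgeSet) :
    (H.copyCount J : ℝ) < expectedCopies n p J := by
  rw [← expectedCopies_mul_card_aut, labelledCopyCount_eq_copyCount_mul_card_aut, Nat.cast_mul] at h
  exact lt_of_mul_lt_mul_right h (Nat.cast_nonneg _)

variable {n : ℕ} {q : unitInterval} {H : SimpleGraph V}

lemma IsSparse.card_aut_le_descFactorial_mul (h : IsSparse n q H) [Fintype W]
    {J : SimpleGraph W} (f : J.Copy H) :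
    (Nat.card (J ≃g J) : ℝ) ≤
      (n.descFactorial (Fintype.card W) : ℝ) * (q : ℝ) ^ Nat.card J.edgeSet := by
  rw [← expectedCopies_mul_card_aut, expectedCopies_congr n q f.isoToSubgraph]
  exact le_mul_of_one_le_left (Nat.cast_nonneg _) (h _)

lemma IsSparse.card_aut_le_pow_mul (h : IsSparse n q H) [Fintype W] {J : SimpleGraph W}
    (f : J.Copy H) :
    (Nat.card (J ≃g J) : ℝ) ≤ (n : ℝ) ^ Fintype.card W * (q : ℝ) ^ Nat.card J.edgeSet := by
  refine (h.card_aut_le_descFactorial_mul f).trans ?_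
  have := q.2.1
  gcongr
  exact_mod_cast Nat.descFactorial_le_pow _ _

lemma IsSparse.card_le [Fintype V] (h : IsSparse n q H) : Fintype.card V ≤ n := by
  by_contra! hlt
  have haut := h.card_aut_le_descFactorial_mul (SimpleGraph.Copy.id H)
  rw [Nat.descFactorial_eq_zero_iff_lt.2 hlt, Nat.cast_zero, zero_mul] at haut
  exact (card_aut_pos H).not_ge (by exact_mod_cast haut)

end Expectation

section Petals

variable {α β ι : Type*}

/-- The graph obtained from copies of `T` indexed by `ι` by gluing them along `β`. A set of `m`
petals can be permuted arbitrarily, so that the graph has at least `m!` automorphisms. -/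
def petalGraph (T : SimpleGraph (β ⊕ α)) (ι : Type*) : SimpleGraph (β ⊕ ι × α) where
  Adj x y := T.Adj (Sum.map id Prod.snd x) (Sum.map id Prod.snd y) ∧
    ∀ i j a b, x = Sum.inr (i, a) → y = Sum.inr (j, b) → i = j
  symm := ⟨fun _ _ h => ⟨h.1.symm, fun i j a b hx hy => (h.2 j i b a hy hx).symm⟩⟩
  loopless := ⟨fun _ h => T.loopless.irrefl _ h.1⟩

lemma petalGraph_adj_inr_inr {T : SimpleGraph (β ⊕ α)} {i j : ι} {x y : α} :
    (petalGraph T ι).Adj (Sum.inr (i, x)) (Sum.inr (j, y)) ↔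
      i = j ∧ T.Adj (Sum.inr x) (Sum.inr y) := by
  refine ⟨fun h => ⟨h.2 i j x y rfl rfl, h.1⟩, ?_⟩
  rintro ⟨rfl, h⟩
  refine ⟨h, fun _ _ _ _ hx hy => ?_⟩
  simp only [Sum.inr.injEq, Prod.mk.injEq] at hx hy
  rw [← hx.1, ← hy.1]

/-- The automorphisms of `T` that fix `β` pointwise. -/
abbrev RelAut (T : SimpleGraph (β ⊕ α)) : Type _ :=
  {g : Equiv.Perm α // ∀ x y, T.Adj (Sum.map id g x) (Sum.map id g y) ↔ T.Adj x y}

/-- The automorphism of the petal graph that permutes the petals by `σ` and acts on the `i`-th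
petal by `g i`. -/
def petalAut (T : SimpleGraph (β ⊕ α)) (σ : Equiv.Perm ι) (g : ι → RelAut T) :
    petalGraph T ι ≃g petalGraph T ι where
  toEquiv := Equiv.sumCongr (Equiv.refl β) (Equiv.prodShear σ fun i => (g i).1)
  map_rel_iff' := by
    rintro (x | ⟨i, x⟩) (y | ⟨j, y⟩)
    · simp [petalGraph]
    · simpa [petalGraph] using (g j).2 (Sum.inl x) (Sum.inr y)
    · simpa [petalGraph] using (g i).2 (Sum.inr x) (Sum.inl y)
    · simp only [Equiv.sumCongr_apply, Sum.map_inr, Equiv.prodShear_apply,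
        petalGraph_adj_inr_inr, σ.injective.eq_iff]
      refine and_congr_right ?_
      rintro rfl
      exact (g i).2 (Sum.inr x) (Sum.inr y)

lemma petalAut_injective [Nonempty α] (T : SimpleGraph (β ⊕ α)) :
    Function.Injective (fun x : Equiv.Perm ι × (ι → RelAut T) => petalAut T x.1 x.2) := by
  rintro ⟨σ, g⟩ ⟨τ, h⟩ heq
  have hval (i : ι) (a : α) : (σ i, (g i).1 a) = (τ i, (h i).1 a) :=
    Sum.inr_injective (DFunLike.congr_fun heq (Sum.inr (i, a)))
  obtain ⟨a⟩ := ‹Nonempty α›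
  refine Prod.ext (Equiv.ext fun i => congrArg Prod.fst (hval i a)) (funext fun i => ?_)
  exact Subtype.ext <| Equiv.ext fun a => congrArg Prod.snd (hval i a)

lemma factorial_mul_pow_le_card_aut_petalGraph [Finite α] [Nonempty α] [Finite β] [Fintype ι]
    (T : SimpleGraph (β ⊕ α)) :
    (Fintype.card ι).factorial * Nat.card (RelAut T) ^ Fintype.card ι ≤
      Nat.card (petalGraph T ι ≃g petalGraph T ι) := by
  classical
  have : Finite (petalGraph T ι ≃g petalGraph T ι) := DFunLike.finite _
  simpa [Nat.card_prod, Nat.card_pi, Fintype.card_perm] using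
    Nat.card_le_card_of_injective _ (petalAut_injective (ι := ι) T)

/-- The `i`-th of the copies of `T` that make up the petal graph. -/
def petalInclusion (T : SimpleGraph (β ⊕ α)) (i : ι) : T.Copy (petalGraph T ι) where
  toHom :=
    { toFun := Sum.map id (Prod.mk i)
      map_rel' := by
        rintro (x | x) (y | y) h <;> refine ⟨h, ?_⟩ <;> simp +contextual }
  injective' := Sum.map_injective.2 ⟨Function.injective_id, Prod.mk_right_injective i⟩

/-- The map that folds all petals onto one. -/
def petalFold (T : SimpleGraph (β ⊕ α)) (ι : Type*) : petalGraph T ι →g T where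
  toFun := Sum.map id Prod.snd
  map_rel' h := h.1

lemma petalFold_petalInclusion (T : SimpleGraph (β ⊕ α)) (i : ι) (x : β ⊕ α) :
    petalFold T ι (petalInclusion T i x) = x := by
  rcases x with x | x <;> rfl

lemma card_edgeSet_petalGraph_le [Finite α] [Finite β] [Finite ι] {T : SimpleGraph (β ⊕ α)}
    (hT : ∀ b b', ¬ T.Adj (Sum.inl b) (Sum.inl b')) :
    Nat.card ι * Nat.card T.edgeSet ≤ Nat.card (petalGraph T ι).edgeSet := by
  rw [← Nat.card_prod]
  refine Nat.card_le_card_of_injective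
    (fun x : ι × T.edgeSet => (petalInclusion T x.1).mapEdgeSet x.2) ?_
  rintro ⟨i, ⟨e, he⟩⟩ ⟨j, ⟨e', he'⟩⟩ heq
  replace heq : Sym2.map (petalInclusion T i) e = Sym2.map (petalInclusion T j) e' :=
    congrArg Subtype.val heq
  obtain rfl : e = e' := by
    simpa [Sym2.map_map, petalFold_petalInclusion] using congrArg (Sym2.map (petalFold T ι)) heq
  obtain ⟨a, ha⟩ : ∃ a, Sum.inr a ∈ e := by
    induction e with | _ u v =>
    rcases u with u | u
    · rcases v with v | v
      · exact absurd he (hT u v)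
      · exact ⟨v, Sym2.mem_mk_right _ _⟩
    · exact ⟨u, Sym2.mem_mk_left _ _⟩
  have hpetal : (Sum.inr (i, a) : β ⊕ ι × α) ∈ Sym2.map (petalInclusion T j) e :=
    heq ▸ Sym2.mem_map.2 ⟨_, ha, rfl⟩
  obtain ⟨x | x, -, hx⟩ := Sym2.mem_map.1 hpetal
  · exact absurd hx Sum.inl_ne_inr
  · obtain rfl : j = i := congrArg Prod.fst (Sum.inr_injective hx)
    rfl

/-- The copy of the petal graph that is formed by copies of `T` which agree on `β` and are
otherwise disjoint. -/
def petalCopy {V : Type*} {H : SimpleGraph V} {T : SimpleGraph (β ⊕ α)}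
    (hT : ∀ b b', ¬ T.Adj (Sum.inl b) (Sum.inl b')) (b : β ↪ V) (c : ι → T.Copy H)
    (hb : ∀ i x, c i (Sum.inl x) = b x)
    (hdisj : ∀ i j a a', c i (Sum.inr a) = c j (Sum.inr a') → i = j) :
    (petalGraph T ι).Copy H where
  toHom :=
    { toFun := Sum.elim b fun x => c x.1 (Sum.inr x.2)
      map_rel' := by
        rintro (x | ⟨i, x⟩) (y | ⟨j, y⟩) h
        · exact absurd h.1 (hT x y)
        · exact (congrArg (H.Adj · _) (hb j x)).mp ((c j).toHom.map_adj h.1)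
        · exact (congrArg (H.Adj _) (hb i y)).mp ((c i).toHom.map_adj h.1)
        · obtain ⟨rfl, hxy⟩ := petalGraph_adj_inr_inr.1 h
          exact (c i).toHom.map_adj hxy }
  injective' := by
    rintro (x | ⟨i, x⟩) (y | ⟨j, y⟩) h
    · exact congrArg _ (b.injective h)
    · exact absurd ((c j).injective ((hb j x).trans h)) Sum.inl_ne_inr
    · exact absurd ((c i).injective (h.trans (hb i y).symm)) Sum.inr_ne_inl
    · obtain rfl : i = j := hdisj i j x y h
      obtain rfl : x = y := Sum.inr_injective ((c i).injective h)
      rfl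

lemma IsSparse.factorial_mul_pow_le {n : ℕ} {q : unitInterval} {V : Type*} {H : SimpleGraph V}
    (hH : IsSparse n q H) [Fintype α] [Nonempty α] [Fintype β] [Fintype ι]
    {T : SimpleGraph (β ⊕ α)} (hT : ∀ b b', ¬ T.Adj (Sum.inl b) (Sum.inl b')) (b : β ↪ V)
    (c : ι → T.Copy H) (hb : ∀ i x, c i (Sum.inl x) = b x)
    (hdisj : ∀ i j a a', c i (Sum.inr a) = c j (Sum.inr a') → i = j) :
    ((Fintype.card ι).factorial : ℝ) * (Nat.card (RelAut T) : ℝ) ^ Fintype.card ι ≤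
      (n : ℝ) ^ Fintype.card β *
        ((n : ℝ) ^ Fintype.card α * (q : ℝ) ^ Nat.card T.edgeSet) ^ Fintype.card ι := by
  calc ((Fintype.card ι).factorial : ℝ) * (Nat.card (RelAut T) : ℝ) ^ Fintype.card ι
      ≤ Nat.card (petalGraph T ι ≃g petalGraph T ι) := by
        exact_mod_cast factorial_mul_pow_le_card_aut_petalGraph T
    _ ≤ (n : ℝ) ^ Fintype.card (β ⊕ ι × α) * (q : ℝ) ^ Nat.card (petalGraph T ι).edgeSet :=
        hH.card_aut_le_pow_mul (petalCopy hT b c hb hdisj)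
    _ ≤ (n : ℝ) ^ Fintype.card (β ⊕ ι × α) *
        (q : ℝ) ^ (Fintype.card ι * Nat.card T.edgeSet) := by
        gcongr ?_ * ?_
        exact pow_le_pow_of_le_one q.2.1 q.2.2
          (Nat.card_eq_fintype_card (α := ι) ▸ card_edgeSet_petalGraph_le hT)
    _ = _ := by
        rw [Fintype.card_sum, Fintype.card_prod, pow_add, mul_pow, ← pow_mul, ← pow_mul,
          mul_comm (Fintype.card α), mul_comm (Nat.card T.edgeSet), mul_assoc]

end Petals

section EdgeSets

open scoped Classical

variable {U : Type*}

/-- The edges of `F` inside `S`. -/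
noncomputable def edgesIn (F : SimpleGraph U) (S : Finset U) : Finset (Sym2 U) :=
  {e ∈ S.sym2 | e ∈ F.edgeSet}

/-- The edges of `F` inside `S` that have an endpoint in `R`. -/
noncomputable def edgesTouching (F : SimpleGraph U) (S R : Finset U) : Finset (Sym2 U) :=
  {e ∈ edgesIn F S | ∃ v ∈ e, v ∈ R}

/-- The vertices of `S \ R` that have a neighbour in `R`. -/
noncomputable def outerBoundary (F : SimpleGraph U) (S R : Finset U) : Finset U :=
  {b ∈ S \ R | ∃ r ∈ R, F.Adj b r}

variable {F : SimpleGraph U} {S R : Finset U}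

lemma mk_mem_edgesIn {u v : U} : s(u, v) ∈ edgesIn F S ↔ F.Adj u v ∧ u ∈ S ∧ v ∈ S := by
  simp [edgesIn, and_comm]

lemma mk_mem_edgesTouching {u v : U} :
    s(u, v) ∈ edgesTouching F S R ↔ F.Adj u v ∧ (u ∈ S ∧ v ∈ S) ∧ (u ∈ R ∨ v ∈ R) := by
  simp [edgesTouching, mk_mem_edgesIn, and_assoc]

lemma mem_outerBoundary {b : U} :
    b ∈ outerBoundary F S R ↔ (b ∈ S ∧ b ∉ R) ∧ ∃ r ∈ R, F.Adj b r := by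
  simp [outerBoundary]

lemma card_edgesIn_eq (F : SimpleGraph U) (S R : Finset U) :
    #(edgesIn F S) = #(edgesIn F (S \ R)) + #(edgesTouching F S R) := by
  rw [edgesTouching, ← card_filter_add_card_filter_not (s := edgesIn F S)
    (fun e => ∃ v ∈ e, v ∈ R), add_comm]
  congr 2
  ext e
  induction e with | _ u v =>
  simp [mk_mem_edgesIn]
  tauto

lemma edgesTouching_empty : edgesTouching F S ∅ = ∅ := by
  simp [edgesTouching]

lemma edgesTouching_mono {R' : Finset U} (h : R ⊆ R') :
    edgesTouching F S R ⊆ edgesTouching F S R' :=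
  monotone_filter_right _ fun _ _ ⟨v, hve, hv⟩ => ⟨v, hve, h hv⟩

lemma card_outerBoundary_le (hR : R ⊆ S) : #(outerBoundary F S R) ≤ #(edgesTouching F S R) := by
  choose! r hr using fun b (hb : b ∈ outerBoundary F S R) => (mem_outerBoundary.1 hb).2
  refine card_le_card_of_injOn (fun b => s(b, r b)) (fun b hb => ?_) fun b hb b' hb' h => ?_
  · exact mk_mem_edgesTouching.2
      ⟨(hr b hb).2, ⟨(mem_outerBoundary.1 hb).1.1, hR (hr b hb).1⟩, Or.inr (hr b hb).1⟩
  · rcases Sym2.eq_iff.1 h with h | h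
    · exact h.1
    · exact absurd (h.1 ▸ (hr b' hb').1) (mem_outerBoundary.1 hb).1.2

/-- The part of `F` that an extension from `S \ R` to `S` adds: the edges inside `S` with an
endpoint in `R`, as a graph on the disjoint union of `R` and its outer boundary. -/
def hangingGraph (F : SimpleGraph U) (S R : Finset U) : SimpleGraph (outerBoundary F S R ⊕ R) where
  Adj x y := F.Adj (Sum.elim (↑) (↑) x) (Sum.elim (↑) (↑) y) ∧ (x.isRight ∨ y.isRight)
  symm := ⟨fun _ _ h => ⟨h.1.symm, h.2.symm⟩⟩
  loopless := ⟨fun _ h => F.loopless.irrefl _ h.1⟩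

lemma hangingGraph_not_adj_inl_inl (b b' : outerBoundary F S R) :
    ¬ (hangingGraph F S R).Adj (Sum.inl b) (Sum.inl b') := by
  simp [hangingGraph]

lemma sumElim_outerBoundary_injective :
    Function.Injective (Sum.elim (↑) (↑) : outerBoundary F S R ⊕ R → U) :=
  Subtype.val_injective.sumElim Subtype.val_injective fun b r h =>
    (mem_outerBoundary.1 b.2).1.2 (h ▸ r.2)

lemma sumElim_outerBoundary_mem (hRS : R ⊆ S) (x : outerBoundary F S R ⊕ R) :
    (Sum.elim (↑) (↑) x : U) ∈ S :=
  x.rec (fun b => (mem_outerBoundary.1 b.2).1.1) fun r => hRS r.2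

lemma exists_sumElim_outerBoundary_eq {u v : U} (hu : u ∈ S) (huv : F.Adj u v)
    (h : u ∈ R ∨ v ∈ R) :
    ∃ x : outerBoundary F S R ⊕ R, Sum.elim (↑) (↑) x = u ∧ (u ∈ R → x.isRight) := by
  by_cases huR : u ∈ R
  · exact ⟨Sum.inr ⟨u, huR⟩, rfl, fun _ => rfl⟩
  · have hb : u ∈ outerBoundary F S R :=
      mem_outerBoundary.2 ⟨⟨hu, huR⟩, v, h.resolve_left huR, huv⟩
    exact ⟨Sum.inl ⟨u, hb⟩, rfl, fun h => absurd h huR⟩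

lemma card_edgesTouching_le_card_edgeSet_hangingGraph :
    #(edgesTouching F S R) ≤ Nat.card (hangingGraph F S R).edgeSet := by
  rw [Nat.card_eq_fintype_card, ← SimpleGraph.edgeFinset_card]
  refine (card_le_card fun e he => ?_).trans (card_image_le (f := Sym2.map (Sum.elim (↑) (↑))))
  induction e with | _ u v =>
  obtain ⟨huv, ⟨hu, hv⟩, hR⟩ := mk_mem_edgesTouching.1 he
  obtain ⟨x, rfl, hx⟩ := exists_sumElim_outerBoundary_eq hu huv hR
  obtain ⟨y, rfl, hy⟩ := exists_sumElim_outerBoundary_eq hv huv.symm hR.symm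
  exact mem_image.2 ⟨s(x, y), SimpleGraph.mem_edgeFinset.2 ⟨huv, hR.imp hx hy⟩, rfl⟩

end EdgeSets

section Extensions

open scoped Classical

variable {U V : Type*} [Fintype U] [Fintype V]

/-- The maps that agree with `φ` off `R` and embed `F[S]` into `H`. For `R ⊆ S` these are the
extensions to `S` of the embedding `φ` of `F[S \ R]`. -/
noncomputable def extensions (F : SimpleGraph U) (H : SimpleGraph V) (S R : Finset U)
    (φ : U → V) : Finset (U → V) :=
  {f | (∀ u ∉ R, f u = φ u) ∧ Set.InjOn f S ∧ ∀ u ∈ S, ∀ v ∈ S, F.Adj u v → H.Adj (f u) (f v)}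

variable {F : SimpleGraph U} {H : SimpleGraph V} {S R : Finset U} {φ f : U → V}

lemma mem_extensions : f ∈ extensions F H S R φ ↔ (∀ u ∉ R, f u = φ u) ∧ Set.InjOn f S ∧
    ∀ u ∈ S, ∀ v ∈ S, F.Adj u v → H.Adj (f u) (f v) := by
  simp [extensions]

lemma extensions_anti {S' : Finset U} (h : S' ⊆ S) (φ : U → V) :
    extensions F H S R φ ⊆ extensions F H S' R φ := fun f hf => by
  obtain ⟨hφ, hinj, hadj⟩ := mem_extensions.1 hf
  exact mem_extensions.2
    ⟨hφ, hinj.mono (coe_subset.2 h), fun u hu v hv => hadj u (h hu) v (h hv)⟩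

lemma mem_extensions_of_eqOn {ψ : U → V} (hf : f ∈ extensions F H S R φ) (hS : ∀ u ∈ S, f u = ψ u)
    {A : Finset U} (hA : ∀ u ∉ A, ψ u = φ u) : ψ ∈ extensions F H S A φ := by
  obtain ⟨-, hinj, hadj⟩ := mem_extensions.1 hf
  refine mem_extensions.2 ⟨hA, fun u hu v hv huv => hinj hu hv ?_, fun u hu v hv huv => ?_⟩
  · rwa [hS u hu, hS v hv]
  · rw [← hS u hu, ← hS v hv]
    exact hadj u hu v hv huv

lemma card_extensions_union_le {A A' : Finset U} (φ : U → V) {a b : ℝ}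
    (hb0 : 0 ≤ b) (ha : (#(extensions F H (S \ A') A φ) : ℝ) ≤ a)
    (hb : ∀ ψ, (#(extensions F H S A' ψ) : ℝ) ≤ b) :
    (#(extensions F H S (A ∪ A') φ) : ℝ) ≤ a * b := by
  let ρ (f : U → V) (u : U) : V := if u ∈ A then f u else φ u
  have hρ {f : U → V} (hf : f ∈ extensions F H S (A ∪ A') φ) : ∀ u ∉ A', f u = ρ f u := by
    intro u hu
    by_cases hA : u ∈ A
    · simp [ρ, hA]
    · simp [ρ, hA, (mem_extensions.1 hf).1 u (by simp [hA, hu])]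
  have hmaps : ∀ f ∈ extensions F H S (A ∪ A') φ, ρ f ∈ extensions F H (S \ A') A φ :=
    fun f hf => mem_extensions_of_eqOn (extensions_anti sdiff_subset _ hf)
      (fun u hu => hρ hf u (mem_sdiff.1 hu).2) fun u hu => by simp [ρ, hu]
  rw [card_eq_sum_card_fiberwise hmaps, Nat.cast_sum]
  calc _ ≤ ∑ _g ∈ extensions F H (S \ A') A φ, b := by
        refine sum_le_sum fun g _ => (Nat.cast_le.2 (card_le_card fun f hf' => ?_)).trans (hb g)
        obtain ⟨hf, rfl⟩ := mem_filter.1 hf'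
        exact mem_extensions.2 ⟨hρ hf, (mem_extensions.1 hf).2⟩
    _ ≤ a * b := by
        rw [sum_const, nsmul_eq_mul]
        gcongr

lemma card_extensions_empty_le (φ : U → V) : #(extensions F H S ∅ φ) ≤ 1 :=
  card_le_one.2 fun f hf g hg => funext fun u => by
    rw [(mem_extensions.1 hf).1 u (notMem_empty u), (mem_extensions.1 hg).1 u (notMem_empty u)]

lemma card_extensions_le_pow (φ : U → V) : #(extensions F H S R φ) ≤ Fintype.card V ^ #R := by
  suffices #(extensions F H S R φ) ≤ Fintype.card (R → V) by simpa
  refine card_le_card_of_injOn (fun f u => f u) (fun _ _ => mem_univ _) fun f hf g hg h => ?_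
  ext u
  by_cases hu : u ∈ R
  · exact congrFun h ⟨u, hu⟩
  · rw [(mem_extensions.1 hf).1 u hu, (mem_extensions.1 hg).1 u hu]

/-- The copy of the hanging graph that an extension yields. -/
def hangingCopy (hRS : R ⊆ S) (hf : f ∈ extensions F H S R φ) : (hangingGraph F S R).Copy H where
  toHom :=
    { toFun := fun x => f (Sum.elim (↑) (↑) x)
      map_rel' := fun {x y} h => (mem_extensions.1 hf).2.2 _ (sumElim_outerBoundary_mem hRS x) _
        (sumElim_outerBoundary_mem hRS y) h.1 }
  injective' := fun x y h => sumElim_outerBoundary_injective <|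
    (mem_extensions.1 hf).2.1 (sumElim_outerBoundary_mem hRS x) (sumElim_outerBoundary_mem hRS y) h

/-- A family of extensions with disjoint images of `R`. -/
def IsPacking (R : Finset U) (P : Finset (U → V)) : Prop :=
  ∀ f ∈ P, ∀ g ∈ P, ∀ a ∈ R, ∀ a' ∈ R, f a = g a' → f = g

lemma IsSparse.factorial_card_le_of_isPacking {n : ℕ} {q : unitInterval} (hH : IsSparse n q H)
    (hRS : R ⊆ S) (hR : R.Nonempty) {P : Finset (U → V)} (hP : P ⊆ extensions F H S R φ)
    (hP0 : P.Nonempty) (hPack : IsPacking R P) :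
    ((#P).factorial : ℝ) ≤ (n : ℝ) ^ #(outerBoundary F S R) *
      ((n : ℝ) ^ #R * (q : ℝ) ^ #(edgesTouching F S R)) ^ #P := by
  obtain ⟨f₀, hf₀⟩ := hP0
  have : Nonempty R := hR.to_subtype
  have : Nonempty (RelAut (hangingGraph F S R)) := ⟨⟨1, by simp⟩⟩
  have hfix {f : U → V} (hf : f ∈ P) (x : outerBoundary F S R) : f x = φ x :=
    (mem_extensions.1 (hP hf)).1 x (mem_outerBoundary.1 x.2).1.2
  have hb : Function.Injective fun x : outerBoundary F S R => φ x := fun x y hxy =>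
    Sum.inl_injective <| (hangingCopy hRS (hP hf₀)).injective <|
      (hfix hf₀ x).trans <| hxy.trans (hfix hf₀ y).symm
  have hpetals := hH.factorial_mul_pow_le (ι := P) hangingGraph_not_adj_inl_inl ⟨_, hb⟩
    (fun f => hangingCopy hRS (hP f.2)) (fun f x => hfix f.2 x)
    fun f g a a' h => Subtype.ext (hPack f f.2 g g.2 a a.2 a' a'.2 h)
  simp only [Fintype.card_coe] at hpetals
  calc ((#P).factorial : ℝ)
      ≤ (#P).factorial * (Nat.card (RelAut (hangingGraph F S R)) : ℝ) ^ #P :=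
        le_mul_of_one_le_right (by positivity) <| one_le_pow₀ <| by exact_mod_cast Nat.card_pos
    _ ≤ _ := hpetals
    _ ≤ _ := by
        have hq0 := q.2.1
        gcongr ?_ * (?_ * ?_) ^ _
        exact pow_le_pow_of_le_one hq0 q.2.2 card_edgesTouching_le_card_edgeSet_hangingGraph

end Extensions

section Weights

open scoped Classical

variable {U V : Type*}

/-- The expected number `x ^ |S| * y ^ e(S)` of copies of `F[S]`, up to lower order factors, in the
random graph with `x` vertices and edge probability `y`. -/
noncomputable def weight (x y : ℝ) (F : SimpleGraph U) (S : Finset U) : ℝ :=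
  x ^ #S * y ^ #(edgesIn F S)

/-- The expected number of ways to extend a copy of `F[S \ R]` to one of `F[S]`. -/
noncomputable def relWeight (x y : ℝ) (F : SimpleGraph U) (S R : Finset U) : ℝ :=
  x ^ #R * y ^ #(edgesTouching F S R)

variable {F : SimpleGraph U} {H : SimpleGraph V} {S R : Finset U} {φ f : U → V} {x y : ℝ}
  {n : ℕ} {q : unitInterval}

lemma weight_eq_mul_relWeight (hR : R ⊆ S) :
    weight x y F S = weight x y F (S \ R) * relWeight x y F S R := by
  rw [weight, weight, relWeight, card_edgesIn_eq F S R, pow_add,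
    ← card_sdiff_add_card_eq_card hR, pow_add]
  ring

lemma card_edgeSet_induce : Nat.card (F.induce (S : Set U)).edgeSet = #(edgesIn F S) := by
  rw [Nat.card_eq_fintype_card, ← SimpleGraph.edgeFinset_card,
    ← card_map (Function.Embedding.subtype (· ∈ (S : Set U))).sym2Map]
  congr 1
  ext e
  induction e with | _ u v =>
  simp only [mem_map, SimpleGraph.mem_edgeFinset, mk_mem_edgesIn]
  refine ⟨?_, fun ⟨huv, hu, hv⟩ => ⟨s(⟨u, hu⟩, ⟨v, hv⟩), huv, rfl⟩⟩
  rintro ⟨e, he, h⟩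
  induction e with | _ a b =>
  rcases Sym2.eq_iff.1 h with ⟨rfl, rfl⟩ | ⟨rfl, rfl⟩
  · exact ⟨he, a.2, b.2⟩
  · exact ⟨SimpleGraph.Adj.symm (G := F) he, b.2, a.2⟩

lemma IsSparse.one_le_weight (hH : IsSparse n q H) (c : F.Copy H) (S : Finset U) :
    1 ≤ weight n q F S := by
  calc (1 : ℝ) ≤ Nat.card (F.induce (S : Set U) ≃g F.induce (S : Set U)) := by
        exact_mod_cast card_aut_pos (F.induce (S : Set U))
    _ ≤ (n : ℝ) ^ Fintype.card S * (q : ℝ) ^ Nat.card (F.induce (S : Set U)).edgeSet :=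
        hH.card_aut_le_pow_mul (c.comp (SimpleGraph.Copy.induce F (S : Set U)))
    _ = weight n q F S := by rw [Fintype.card_coe, card_edgeSet_induce, weight]

lemma IsSparse.two_pow_le_weight (hH : IsSparse n q H) (c : F.Copy H) (S : Finset U) :
    (2 : ℝ) ^ #(edgesIn F S) ≤ weight n (2 * q) F S := by
  calc (2 : ℝ) ^ #(edgesIn F S) ≤ 2 ^ #(edgesIn F S) * weight n q F S :=
        le_mul_of_one_le_right (by positivity) (hH.one_le_weight c S)
    _ = weight n (2 * q) F S := by
        rw [weight, weight, mul_pow]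
        ring

/-- Take `X ⊇ Y` of minimal weight, and as large as possible among these. -/
lemma IsSparse.exists_superset_weight_lt [Finite V] (hH : IsSparse n q H)
    (hq : 2 * (q : ℝ) ≤ 1) (Y : Finset V) :
    ∃ X, Y ⊆ X ∧ (2 : ℝ) ^ #(edgesIn H X) ≤ (n : ℝ) ^ #Y ∧
      ∀ X', X ⊂ X' → weight n (2 * q) H X < weight n (2 * q) H X' := by
  have := Fintype.ofFinite V
  obtain ⟨X₀, hX₀, hmin⟩ := exists_min_image {X | Y ⊆ X} (weight n (2 * q) H) ⟨Y, by simp⟩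
  obtain ⟨X, hX, hmax⟩ := exists_max_image
    {X | Y ⊆ X ∧ weight n (2 * q) H X ≤ weight n (2 * q) H X₀} card ⟨X₀, by simpa using hX₀⟩
  simp only [mem_filter, mem_univ, true_and] at hX₀ hmin hX hmax
  refine ⟨X, hX.1, ?_, fun X' hX' => ?_⟩
  · have hq0 := q.2.1
    calc (2 : ℝ) ^ #(edgesIn H X) ≤ weight n (2 * q) H X :=
          hH.two_pow_le_weight (SimpleGraph.Copy.id H) X
      _ ≤ weight n (2 * q) H Y := hX.2.trans (hmin Y Subset.rfl)
      _ ≤ (n : ℝ) ^ #Y :=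
          mul_le_of_le_one_right (by positivity) (pow_le_one₀ (by positivity) hq)
  · by_contra! hle
    exact (card_lt_card hX').not_ge (hmax X' ⟨hX.1.trans hX'.1, hle.trans hX.2⟩)

lemma mem_of_mem_edgesTouching {e : Sym2 U} (he : e ∈ edgesTouching F S R) : ∀ v ∈ e, v ∈ S := by
  simp only [edgesTouching, edgesIn, mem_filter, mem_sym2_iff] at he
  exact he.1.1

lemma sym2_map_injOn {s : Set U} (hf : Set.InjOn f s) :
    Set.InjOn (Sym2.map f) {e | ∀ v ∈ e, v ∈ s} := by
  intro e he e' he' h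
  induction e with | _ u v =>
  induction e' with | _ u' v' =>
  simp only [Set.mem_ofPred_eq, Sym2.mem_iff, forall_eq_or_imp, forall_eq] at he he'
  simp only [Sym2.map_mk, Sym2.eq_iff] at h ⊢
  exact h.imp (fun h => ⟨hf he.1 he'.1 h.1, hf he.2 he'.2 h.2⟩)
    fun h => ⟨hf he.1 he'.2 h.1, hf he.2 he'.1 h.2⟩

lemma card_image_edgesTouching (hf : Set.InjOn f S) :
    #((edgesTouching F S R).image (Sym2.map f)) = #(edgesTouching F S R) :=
  card_image_of_injOn <| (sym2_map_injOn hf).mono fun _ he => mem_of_mem_edgesTouching he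

lemma mem_or_mem_outerBoundary {u v : U} (h : s(u, v) ∈ edgesTouching F S R) :
    u ∈ R ∨ u ∈ outerBoundary F S R := by
  rw [mk_mem_edgesTouching] at h
  by_cases hu : u ∈ R
  · exact Or.inl hu
  · exact Or.inr (mem_outerBoundary.2 ⟨⟨h.2.1.1, hu⟩, v, h.2.2.resolve_left hu, h.1⟩)

variable [Fintype U] [Fintype V]

lemma image_edgesTouching_subset {T : Finset U} (hf : f ∈ extensions F H S R φ) {X : Finset V}
    (hT : ∀ t ∈ T, f t ∈ X) (hb : ∀ b ∈ outerBoundary F S T, f b ∈ X) :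
    (edgesTouching F S T).image (Sym2.map f) ⊆ edgesIn H X := by
  refine image_subset_iff.2 fun e he => ?_
  induction e with | _ u v =>
  obtain ⟨huv, ⟨hu, hv⟩, -⟩ := mk_mem_edgesTouching.1 he
  have hX {u v : U} (h : s(u, v) ∈ edgesTouching F S T) : f u ∈ X :=
    (mem_or_mem_outerBoundary h).elim (hT u) (hb u)
  exact mk_mem_edgesIn.2
    ⟨(mem_extensions.1 hf).2.2 u hu v hv huv, hX he, hX (v := u) (by rwa [Sym2.eq_swap])⟩

lemma weight_union_image_le {T : Finset U} (hx : 0 ≤ x) (hy0 : 0 ≤ y) (hy1 : y ≤ 1)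
    (hf : f ∈ extensions F H S R φ) (hTS : T ⊆ S) {X : Finset V} (hT : ∀ t ∈ T, f t ∉ X)
    (hb : ∀ b ∈ outerBoundary F S T, f b ∈ X) :
    weight x y H (X ∪ T.image f) ≤ weight x y H X * relWeight x y F S T := by
  have hinj := (mem_extensions.1 hf).2.1
  have hcard : #(X ∪ T.image f) = #X + #T := by
    rw [card_union_of_disjoint (disjoint_right.2 (forall_mem_image.2 hT)),
      card_image_of_injOn (hinj.mono (coe_subset.2 hTS))]
  have hdisj : Disjoint (edgesIn H X) ((edgesTouching F S T).image (Sym2.map f)) := by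
    refine disjoint_right.2 (forall_mem_image.2 fun e he heX => ?_)
    induction e with | _ u v =>
    obtain ⟨-, hu, hv⟩ := mk_mem_edgesIn.1 heX
    exact (mk_mem_edgesTouching.1 he).2.2.elim (fun h => hT u h hu) fun h => hT v h hv
  have hedges : #(edgesIn H X) + #(edgesTouching F S T) ≤ #(edgesIn H (X ∪ T.image f)) := by
    rw [← card_image_edgesTouching hinj, ← card_union_of_disjoint hdisj]
    refine card_le_card (union_subset (fun e he => ?_) <| image_edgesTouching_subset hf
      (fun t ht => mem_union_right _ (mem_image_of_mem f ht)) fun b h => mem_union_left _ (hb b h))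
    induction e with | _ u v =>
    obtain ⟨huv, hu, hv⟩ := mk_mem_edgesIn.1 he
    exact mk_mem_edgesIn.2 ⟨huv, mem_union_left _ hu, mem_union_left _ hv⟩
  calc weight x y H (X ∪ T.image f)
      ≤ x ^ (#X + #T) * y ^ (#(edgesIn H X) + #(edgesTouching F S T)) := by
        rw [weight, hcard]
        exact mul_le_mul_of_nonneg_left (pow_le_pow_of_le_one hy0 hy1 hedges) (by positivity)
    _ = weight x y H X * relWeight x y F S T := by
        rw [weight, relWeight, pow_add, pow_add]
        ring

/-- Otherwise, adding to `X` the part of the image that leaves it would not increase the weight. -/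
lemma mem_of_forall_relWeight_le_one (hx : 0 ≤ x) (hy0 : 0 ≤ y) (hy1 : y ≤ 1) {X : Finset V}
    (hX : ∀ X', X ⊂ X' → weight x y H X < weight x y H X') (hRS : R ⊆ S)
    (hw : ∀ T ⊆ R, relWeight x y F S T ≤ 1) (hf : f ∈ extensions F H S R φ)
    (hφ : ∀ b ∈ outerBoundary F S R, φ b ∈ X) : ∀ r ∈ R, f r ∈ X := by
  by_contra! hcon
  obtain ⟨r, hr, hrX⟩ := hcon
  set T : Finset U := {r ∈ R | f r ∉ X}
  have hTR : T ⊆ R := filter_subset _ _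
  have hb : ∀ b ∈ outerBoundary F S T, f b ∈ X := by
    intro b hb
    obtain ⟨⟨hbS, hbT⟩, t, ht, hbt⟩ := mem_outerBoundary.1 hb
    by_cases hbR : b ∈ R
    · by_contra hbX
      exact hbT (mem_filter.2 ⟨hbR, hbX⟩)
    · rw [(mem_extensions.1 hf).1 b hbR]
      exact hφ b (mem_outerBoundary.2 ⟨⟨hbS, hbR⟩, t, hTR ht, hbt⟩)
  have hlt : weight x y H X < weight x y H (X ∪ T.image f) :=
    hX _ ⟨subset_union_left, fun h => hrX <| h <| mem_union_right _ <|
      mem_image_of_mem f (mem_filter.2 ⟨hr, hrX⟩)⟩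
  have hle := weight_union_image_le hx hy0 hy1 hf (hTR.trans hRS)
    (fun t ht => (mem_filter.1 ht).2) hb
  have hweight : 0 ≤ weight x y H X := by
    rw [weight]
    positivity
  exact (hlt.trans_le hle).not_ge (mul_le_of_le_one_right hweight (hw T hTR))

end Weights

section Connectivity

open scoped Classical

variable {U : Type*} {F : SimpleGraph U} {R : Finset U}

lemma exists_adj_of_preconnected_induce (hR : (F.induce (R : Set U)).Preconnected)
    {A : Finset U} (hAR : A ⊂ R) (hA : A.Nonempty) : ∃ a ∈ A, ∃ v ∈ R \ A, F.Adj a v := by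
  obtain ⟨a, ha⟩ := hA
  obtain ⟨r, hrR, hrA⟩ := exists_of_ssubset hAR
  obtain ⟨p⟩ := hR ⟨a, hAR.1 ha⟩ ⟨r, hrR⟩
  obtain ⟨d, -, hd, hd'⟩ := p.exists_boundary_dart {z | z.1 ∈ A} ha hrA
  exact ⟨d.fst, hd, d.snd, mem_sdiff.2 ⟨d.snd.2, hd'⟩, d.adj⟩

/-- Growing a connected set from one of its vertices. -/
lemma preconnected_induce_induction {P : Finset U → Prop}
    (hR : (F.induce (R : Set U)).Preconnected) {r : U} (hr : r ∈ R) (singleton : P {r})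
    (insert : ∀ A ⊂ R, ∀ a ∈ A, ∀ v ∈ R \ A, F.Adj a v → P A → P (insert v A)) : P R := by
  suffices ∀ m < #R, ∃ A ⊆ R, #A = m + 1 ∧ P A by
    obtain ⟨A, hAR, hA, hP⟩ := this (#R - 1) (by have := card_pos.2 ⟨r, hr⟩; omega)
    rwa [← eq_of_subset_of_card_le hAR (by omega)]
  intro m
  induction m with
  | zero => exact fun _ => ⟨{r}, singleton_subset_iff.2 hr, card_singleton r, singleton⟩
  | succ m ih =>
    intro hm
    obtain ⟨A, hAR, hA, hP⟩ := ih (by omega)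
    have hss : A ⊂ R := hAR.ssubset_of_ne (by rintro rfl; omega)
    obtain ⟨a, ha, v, hv, hav⟩ :=
      exists_adj_of_preconnected_induce hR hss (card_pos.1 (by omega))
    refine ⟨_, insert_subset (mem_sdiff.1 hv).1 hAR, ?_, insert A hss a ha v hv hav hP⟩
    rw [card_insert_of_notMem (mem_sdiff.1 hv).2, hA]

lemma exists_split_of_not_preconnected_induce (hR : ¬ (F.induce (R : Set U)).Preconnected) :
    ∃ A ⊂ R, A.Nonempty ∧ ∀ a ∈ A, ∀ b ∈ R \ A, ¬ F.Adj a b := by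
  simp only [SimpleGraph.Preconnected, not_forall] at hR
  obtain ⟨x, y, hxy⟩ := hR
  let A : Finset U := ({z : R | (F.induce (R : Set U)).Reachable x z} : Finset R).map
    (Function.Embedding.subtype _)
  have hA {z : U} : z ∈ A ↔ ∃ h : z ∈ R, (F.induce (R : Set U)).Reachable x ⟨z, h⟩ := by
    simp [A]
  refine ⟨A, ⟨fun z hz => (hA.1 hz).1, fun h => ?_⟩, ⟨x, hA.2 ⟨x.2, .rfl⟩⟩, ?_⟩
  · exact hxy (hA.1 (h y.2)).2
  · rintro a ha b hb hab
    obtain ⟨haR, hxa⟩ := hA.1 ha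
    obtain ⟨hbR, hbA⟩ := mem_sdiff.1 hb
    have hab' : (F.induce (R : Set U)).Adj ⟨a, haR⟩ ⟨b, hbR⟩ := hab
    exact hbA (hA.2 ⟨hbR, hxa.trans hab'.reachable⟩)

/-- Induction over the connected components of `F[R]`. -/
lemma component_induction {P : Finset U → Prop} (empty : P ∅)
    (connected : ∀ R : Finset U, (F.induce (R : Set U)).Connected → P R)
    (union : ∀ A B : Finset U, Disjoint A B → (∀ a ∈ A, ∀ b ∈ B, ¬ F.Adj a b) →
      P A → P B → P (A ∪ B)) (R : Finset U) : P R := by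
  induction R using Finset.strongInduction with | _ R ih =>
  rcases R.eq_empty_or_nonempty with rfl | ⟨r, hr⟩
  · exact empty
  by_cases hR : (F.induce (R : Set U)).Preconnected
  · exact connected R { preconnected := hR, nonempty := ⟨⟨r, hr⟩⟩ }
  · obtain ⟨A, hAR, hA, hsplit⟩ := exists_split_of_not_preconnected_induce hR
    rw [← union_sdiff_of_subset hAR.1]
    exact union A (R \ A) disjoint_sdiff hsplit (ih A hAR) (ih _ (sdiff_ssubset hAR.1 hA))

end Connectivity

section EdgeImages

open scoped Classical

variable {U V : Type*} {F : SimpleGraph U} {H : SimpleGraph V} {S R : Finset U} {φ f : U → V}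

lemma card_image_piecewise_insert_le [DecidableEq (U → V)] {Φ : Finset (U → V)} {A : Finset U}
    {v : U} {d : ℕ} {C : (U → V) → Finset V} (hd : ∀ f ∈ Φ, #(C f) ≤ d)
    (hC : ∀ f ∈ Φ, ∀ g ∈ Φ, (∀ u ∈ A, f u = g u) → f v ∈ C g) :
    #(Φ.image fun f => (insert v A).piecewise f φ) ≤ d * #(Φ.image fun f => A.piecewise f φ) := by
  choose! g hgΦ hg using fun ψ (hψ : ψ ∈ Φ.image fun f => A.piecewise f φ) => mem_image.1 hψ
  rw [mul_comm]
  refine (card_le_card (image_subset_iff.2 fun f hf => ?_)).trans <|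
    card_biUnion_le_card_mul (Φ.image fun f => A.piecewise f φ)
      (fun ψ => (C (g ψ)).image (Function.update ψ v)) d fun ψ hψ =>
        card_image_le.trans (hd _ (hgΦ ψ hψ))
  have hψ : A.piecewise f φ ∈ Φ.image fun f => A.piecewise f φ := mem_image_of_mem _ hf
  refine mem_biUnion.2 ⟨_, hψ, mem_image.2 ⟨f v, hC f hf _ (hgΦ _ hψ) fun u hu => ?_, ?_⟩⟩
  · simpa [hu] using (congrFun (hg _ hψ) u).symm
  · rw [piecewise_insert]

lemma card_biUnion_toFinset_le (D : Finset (Sym2 V)) : #(D.biUnion Sym2.toFinset) ≤ 2 * #D := by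
  rw [mul_comm]
  refine card_biUnion_le_card_mul _ _ _ fun e _ => ?_
  rw [Sym2.card_toFinset]
  split <;> omega

variable [Fintype U]

lemma mem_image_neighborFinset_of_image_edgesTouching_eq {g : U → V} (hg : Set.InjOn g S)
    (himage : (edgesTouching F S R).image (Sym2.map f) = (edgesTouching F S R).image (Sym2.map g))
    {a v : U} (hav : s(a, v) ∈ edgesTouching F S R) (hfa : f a = g a) :
    f v ∈ (F.neighborFinset a).image g := by
  have hmem : s(g a, f v) ∈ (edgesTouching F S R).image (Sym2.map g) := by
    rw [← himage, ← hfa]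
    exact mem_image_of_mem (Sym2.map f) hav
  obtain ⟨e, he, heq⟩ := mem_image.1 hmem
  have haS : a ∈ S := mem_of_mem_edgesTouching hav a (Sym2.mem_mk_left a v)
  obtain ⟨w, hwe, hwa⟩ := Sym2.mem_map.1 (heq ▸ Sym2.mem_mk_left (g a) (f v))
  obtain rfl : w = a := hg (mem_of_mem_edgesTouching he w hwe) haS hwa
  obtain ⟨z, rfl⟩ := hwe
  refine mem_image.2 ⟨z, ?_, Sym2.congr_right.1 heq⟩
  exact (F.mem_neighborFinset w z).2 (mk_mem_edgesTouching.1 he).1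

variable [Fintype V]

lemma image_piecewise_eq_self {Φ : Finset (U → V)} (hΦ : Φ ⊆ extensions F H S R φ) :
    (Φ.image fun f => R.piecewise f φ) = Φ := by
  conv_rhs => rw [← image_id (s := Φ)]
  refine image_congr fun f hf => funext fun u => ?_
  by_cases hu : u ∈ R
  · simp [hu]
  · simp [hu, (mem_extensions.1 (hΦ hf)).1 u hu]

/-- The root has at most `2 * #D` images, and every further vertex, reached along an edge `a v`,
at most `d` once the image of `a` is known. -/
lemma card_le_of_image_edgesTouching_eq (hRS : R ⊆ S)
    (hconn : (F.induce (R : Set U)).Preconnected) {d : ℕ} (hdeg : ∀ r ∈ R, F.degree r ≤ d)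
    (hedge : (edgesTouching F S R).Nonempty) {D : Finset (Sym2 V)} {Φ : Finset (U → V)}
    (hΦ : Φ ⊆ extensions F H S R φ)
    (hD : ∀ f ∈ Φ, (edgesTouching F S R).image (Sym2.map f) = D) :
    #Φ ≤ 2 * #D * d ^ (#R - 1) := by
  obtain ⟨r, hr, w, hrw⟩ : ∃ r ∈ R, ∃ w, s(r, w) ∈ edgesTouching F S R := by
    obtain ⟨e, he⟩ := hedge
    induction e with | _ u v =>
    rcases (mk_mem_edgesTouching.1 he).2.2 with h | h
    · exact ⟨u, h, v, he⟩
    · exact ⟨v, h, u, by rwa [Sym2.eq_swap]⟩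
  suffices #(Φ.image fun f => R.piecewise f φ) ≤ 2 * #D * d ^ (#R - 1) by
    rwa [image_piecewise_eq_self hΦ] at this
  refine preconnected_induce_induction
    (P := fun A => #(Φ.image fun f => A.piecewise f φ) ≤ 2 * #D * d ^ (#A - 1)) hconn hr ?_ ?_
  · have hroot := card_image_piecewise_insert_le (φ := φ) (A := ∅) (v := r)
      (fun f (_ : f ∈ Φ) => card_biUnion_toFinset_le D) fun f hf _ _ _ => mem_biUnion.2
        ⟨s(f r, f w), hD f hf ▸ mem_image_of_mem (Sym2.map f) hrw, by simp⟩
    rw [insert_empty_eq] at hroot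
    rw [card_singleton, pow_zero]
    refine hroot.trans (Nat.mul_le_mul_left _ (card_le_one.2 ?_))
    simp
  · intro A hAR a ha v hv hav ih
    obtain ⟨hvR, hvA⟩ := mem_sdiff.1 hv
    have hav' : s(a, v) ∈ edgesTouching F S R :=
      mk_mem_edgesTouching.2 ⟨hav, ⟨hRS (hAR.1 ha), hRS hvR⟩, Or.inr hvR⟩
    have hstep := card_image_piecewise_insert_le (φ := φ) (A := A) (v := v)
      (fun g (_ : g ∈ Φ) => card_image_le.trans (hdeg a (hAR.1 ha)))
      fun f hf g hg hfg => mem_image_neighborFinset_of_image_edgesTouching_eq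
        (mem_extensions.1 (hΦ hg)).2.1 ((hD f hf).trans (hD g hg).symm) hav' (hfg a ha)
    obtain ⟨m, hm⟩ : ∃ m, #A = m + 1 := ⟨#A - 1, by have := card_pos.2 ⟨a, ha⟩; omega⟩
    rw [card_insert_of_notMem hvA, hm]
    rw [hm] at ih
    calc _ ≤ d * #(Φ.image fun f => A.piecewise f φ) := hstep
      _ ≤ d * (2 * #D * d ^ (m + 1 - 1)) := by gcongr
      _ = 2 * #D * d ^ (m + 1 + 1 - 1) := by
        simp only [Nat.add_sub_cancel]
        ring

lemma card_extensions_le_choose_mul (hRS : R ⊆ S) (hconn : (F.induce (R : Set U)).Preconnected)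
    {d : ℕ} (hdeg : ∀ r ∈ R, F.degree r ≤ d) (hedge : (edgesTouching F S R).Nonempty)
    {X : Finset V} (hX : ∀ f ∈ extensions F H S R φ, ∀ r ∈ R, f r ∈ X)
    (hφ : ∀ b ∈ outerBoundary F S R, φ b ∈ X) :
    #(extensions F H S R φ) ≤ (#(edgesIn H X)).choose #(edgesTouching F S R) *
      (2 * #(edgesTouching F S R) * d ^ (#R - 1)) := by
  have hmaps : ∀ f ∈ extensions F H S R φ, (edgesTouching F S R).image (Sym2.map f) ∈
      (edgesIn H X).powersetCard #(edgesTouching F S R) := fun f hf => by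
    obtain ⟨hfφ, hinj, -⟩ := mem_extensions.1 hf
    refine mem_powersetCard.2 ⟨image_edgesTouching_subset hf (hX f hf) fun b hb => ?_,
      card_image_edgesTouching hinj⟩
    rw [hfφ b (mem_outerBoundary.1 hb).1.2]
    exact hφ b hb
  rw [card_eq_sum_card_fiberwise hmaps, ← card_powersetCard, ← smul_eq_mul]
  refine sum_le_card_nsmul _ _ _ fun D hD => ?_
  rw [← (mem_powersetCard.1 hD).2]
  exact card_le_of_image_edgesTouching_eq hRS hconn hdeg hedge (filter_subset _ _)
    fun f hf => (mem_filter.1 hf).2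

end EdgeImages

section Numerics

lemma pow_le_exp_pow_mul_factorial (m : ℕ) :
    (m : ℝ) ^ m ≤ Real.exp 1 ^ m * m.factorial := by
  have hfac : (0 : ℝ) < m.factorial := by exact_mod_cast m.factorial_pos
  rw [← div_le_iff₀ hfac, ← Real.exp_nat_mul, mul_one]
  exact Real.pow_div_factorial_le_exp _ m.cast_nonneg m

lemma choose_le_mul_exp_pow {M k : ℕ} {L : ℝ} (hL : 0 ≤ L) (hM : M ≤ k * L) :
    (M.choose k : ℝ) ≤ (Real.exp 1 * L) ^ k := by
  calc (M.choose k : ℝ) ≤ (M : ℝ) ^ k / k.factorial := Nat.choose_le_pow_div k M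
    _ ≤ (k * L) ^ k / k.factorial := by gcongr
    _ = (k : ℝ) ^ k * L ^ k / k.factorial := by rw [mul_pow]
    _ ≤ Real.exp 1 ^ k * k.factorial * L ^ k / k.factorial := by
        gcongr
        exact pow_le_exp_pow_mul_factorial k
    _ = (Real.exp 1 * L) ^ k := by
        rw [mul_pow]
        field_simp

lemma two_mul_le_two_pow {k : ℕ} (hk : 1 ≤ k) : 2 * k ≤ 2 ^ k := by
  obtain ⟨k, rfl⟩ := Nat.exists_eq_add_of_le' hk
  rw [pow_succ, mul_comm]
  exact Nat.mul_le_mul_right 2 k.lt_two_pow_self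

lemma le_mul_logb_of_two_pow_le {n a b : ℕ} (h : (2 : ℝ) ^ a ≤ (n : ℝ) ^ b) :
    (a : ℝ) ≤ b * Real.logb 2 n := by
  have := Real.logb_le_logb_of_le (b := 2) (by norm_num) (by positivity) h
  rwa [Real.logb_pow, Real.logb_pow, Real.logb_self_eq_one (by norm_num), mul_one] at this

lemma one_le_logb_two {n : ℕ} (hn : 2 ≤ n) : 1 ≤ Real.logb 2 n := by
  rw [Real.le_logb_iff_rpow_le (by norm_num) (by positivity), Real.rpow_one]
  exact_mod_cast hn

lemma one_le_exp_one : 1 ≤ Real.exp 1 := Real.one_le_exp zero_le_one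

lemma pow_le_factorial_of_exp_mul_le {m : ℕ} {x : ℝ} (hx : 0 ≤ x) (h : Real.exp 1 * x ≤ m) :
    x ^ m ≤ m.factorial := by
  refine le_of_mul_le_mul_left ?_ (pow_pos (Real.exp_pos 1) m)
  calc Real.exp 1 ^ m * x ^ m = (Real.exp 1 * x) ^ m := (mul_pow ..).symm
    _ ≤ (m : ℝ) ^ m := by gcongr
    _ ≤ Real.exp 1 ^ m * m.factorial := pow_le_exp_pow_mul_factorial m

lemma le_exp_mul_or_le_logb {m k t n : ℕ} {x : ℝ} (hm : 1 ≤ m) (hk : 1 ≤ k) (hx : 0 ≤ x)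
    (htk : t ≤ k) (h : m.factorial * (2 : ℝ) ^ (k * m) ≤ (n : ℝ) ^ t * x ^ m) :
    m ≤ Real.exp 1 * x ∨ 1 ≤ t ∧ m ≤ Real.logb 2 n := by
  refine or_iff_not_imp_left.2 fun hmx => ?_
  have hfac : (0 : ℝ) < m.factorial := by exact_mod_cast m.factorial_pos
  have hpow : (2 : ℝ) ^ (k * m) ≤ (n : ℝ) ^ t := by
    refine le_of_mul_le_mul_left (h.trans ?_) hfac
    rw [mul_comm]
    gcongr
    exact pow_le_factorial_of_exp_mul_le hx (not_le.1 hmx).le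
  have ht : 1 ≤ t := by
    by_contra! h0
    obtain rfl : t = 0 := by omega
    exact absurd hpow (by simpa using one_lt_pow₀ (a := (2 : ℝ)) one_lt_two (by positivity))
  have hlog : (k * m : ℝ) ≤ t * Real.logb 2 n := by
    exact_mod_cast le_mul_logb_of_two_pow_le hpow
  have hL : 0 ≤ Real.logb 2 n :=
    nonneg_of_mul_nonneg_right (le_trans (by positivity) hlog) (by exact_mod_cast ht)
  have hk0 : (0 : ℝ) < k := by exact_mod_cast hk
  exact ⟨ht, le_of_mul_le_mul_left (hlog.trans (by gcongr)) hk0⟩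

lemma sq_mul_exp_le {r k : ℕ} (hk : 1 ≤ k) (hr : r ≤ k + 1) :
    (r : ℝ) ^ 2 * Real.exp 1 ≤ (4 * Real.exp 1) ^ k := by
  have hr2 : (r : ℝ) ≤ 2 ^ k := by exact_mod_cast hr.trans k.lt_two_pow_self
  calc (r : ℝ) ^ 2 * Real.exp 1 ≤ (2 ^ k) ^ 2 * Real.exp 1 ^ k := by
        gcongr
        exact le_self_pow₀ one_le_exp_one (by omega)
    _ = (4 * Real.exp 1) ^ k := by
        rw [mul_pow, ← pow_mul, mul_comm k 2, pow_mul]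
        norm_num

end Numerics

section SplitWeights

open scoped Classical

variable {U : Type*} {F : SimpleGraph U} {S R T A B : Finset U} {x y : ℝ}

lemma card_edgesTouching_union :
    #(edgesTouching F S (A ∪ B)) = #(edgesTouching F (S \ B) A) + #(edgesTouching F S B) := by
  have hAB := card_edgesIn_eq F S (A ∪ B)
  have hB := card_edgesIn_eq F S B
  have hA := card_edgesIn_eq F (S \ B) A
  rw [sdiff_sdiff_left, sup_eq_union, union_comm] at hA
  omega

lemma relWeight_union (h : Disjoint A B) :
    relWeight x y F S (A ∪ B) = relWeight x y F (S \ B) A * relWeight x y F S B := by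
  rw [relWeight, relWeight, relWeight, card_edgesTouching_union, card_union_of_disjoint h,
    pow_add, pow_add]
  ring

lemma relWeight_sdiff_mul_relWeight_sdiff {T' : Finset U} (hT : T ⊆ T') (hT' : T' ⊆ S) :
    relWeight x y F T' (T' \ T) * relWeight x y F S (S \ T') = relWeight x y F S (S \ T) := by
  rw [← sdiff_union_sdiff_cancel hT' hT, union_comm,
    relWeight_union (disjoint_sdiff.mono_left sdiff_subset), Finset.sdiff_sdiff_eq_self hT']

lemma edgesTouching_sdiff_eq_of_not_adj (hTA : T ⊆ A) (hAB : Disjoint A B)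
    (hadj : ∀ a ∈ A, ∀ b ∈ B, ¬ F.Adj a b) :
    edgesTouching F (S \ B) T = edgesTouching F S T := by
  ext e
  induction e with | _ u v =>
  have hA {a : U} (ha : a ∈ T) : a ∉ B := disjoint_left.1 hAB (hTA ha)
  simp only [mk_mem_edgesTouching, mem_sdiff]
  refine ⟨fun ⟨huv, ⟨hu, hv⟩, hT⟩ => ⟨huv, ⟨hu.1, hv.1⟩, hT⟩, ?_⟩
  rintro ⟨huv, ⟨hu, hv⟩, hT | hT⟩
  · exact ⟨huv, ⟨⟨hu, hA hT⟩, hv, fun hvB => hadj u (hTA hT) v hvB huv⟩, .inl hT⟩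
  · exact ⟨huv, ⟨⟨hu, fun huB => hadj v (hTA hT) u huB huv.symm⟩, hv, hA hT⟩, .inr hT⟩

lemma relWeight_sdiff_eq_of_not_adj (hTA : T ⊆ A) (hAB : Disjoint A B)
    (hadj : ∀ a ∈ A, ∀ b ∈ B, ¬ F.Adj a b) :
    relWeight x y F (S \ B) T = relWeight x y F S T := by
  rw [relWeight, relWeight, edgesTouching_sdiff_eq_of_not_adj hTA hAB hadj]

lemma weight_pos (hx : 0 < x) (hy : 0 < y) : 0 < weight x y F S := by
  rw [weight]
  positivity

lemma relWeight_le_one_iff (hx : 0 < x) (hy : 0 < y) (hR : R ⊆ S) :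
    relWeight x y F S R ≤ 1 ↔ weight x y F S ≤ weight x y F (S \ R) := by
  rw [weight_eq_mul_relWeight hR, mul_le_iff_le_one_right (weight_pos hx hy)]

lemma one_le_relWeight_iff (hx : 0 < x) (hy : 0 < y) (hR : R ⊆ S) :
    1 ≤ relWeight x y F S R ↔ weight x y F (S \ R) ≤ weight x y F S := by
  rw [weight_eq_mul_relWeight hR, le_mul_iff_one_le_right (weight_pos hx hy)]

lemma relWeight_empty : relWeight x y F S ∅ = 1 := by
  simp [relWeight, edgesTouching_empty]

lemma relWeight_mul (c : ℝ) :
    relWeight x (c * y) F S R = c ^ #(edgesTouching F S R) * relWeight x y F S R := by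
  rw [relWeight, relWeight, mul_pow, mul_left_comm]

lemma weight_mul (c : ℝ) : weight x (c * y) F S = c ^ #(edgesIn F S) * weight x y F S := by
  rw [weight, weight, mul_pow, mul_left_comm]

lemma relWeight_eq_weight (hRS : R ⊆ S) (h : outerBoundary F S R = ∅) :
    relWeight x y F S R = weight x y F R := by
  suffices edgesTouching F S R = edgesIn F R by rw [relWeight, weight, this]
  ext e
  induction e with | _ u v =>
  refine ⟨fun he => ?_, fun he => ?_⟩
  · have hu := mem_or_mem_outerBoundary he
    have hv := mem_or_mem_outerBoundary (u := v) (v := u) (by rwa [Sym2.eq_swap])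
    simp only [h, notMem_empty, or_false] at hu hv
    exact mk_mem_edgesIn.2 ⟨(mk_mem_edgesTouching.1 he).1, hu, hv⟩
  · obtain ⟨huv, hu, hv⟩ := mk_mem_edgesIn.1 he
    exact mk_mem_edgesTouching.2 ⟨huv, ⟨hRS hu, hRS hv⟩, Or.inl hu⟩

lemma exists_mem_edgesTouching_of_outerBoundary (hRS : R ⊆ S)
    (hbd : (outerBoundary F S R).Nonempty) :
    ∃ b ∉ R, ∃ r ∈ R, s(b, r) ∈ edgesTouching F S R := by
  obtain ⟨b, hb⟩ := hbd
  obtain ⟨⟨hbS, hbR⟩, r, hr, hbr⟩ := mem_outerBoundary.1 hb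
  exact ⟨b, hbR, r, hr, mk_mem_edgesTouching.2 ⟨hbr, ⟨hbS, hRS hr⟩, Or.inr hr⟩⟩

lemma exists_card_edgesTouching_erase_lt (hRS : R ⊆ S) (hbd : (outerBoundary F S R).Nonempty) :
    ∃ r ∈ R, #(edgesTouching F S (R.erase r)) < #(edgesTouching F S R) := by
  obtain ⟨b, hb, r, hr, hbr⟩ := exists_mem_edgesTouching_of_outerBoundary hRS hbd
  refine ⟨r, hr, card_lt_card ((ssubset_iff_of_subset (edgesTouching_mono (erase_subset _ _))).2
    ⟨_, hbr, fun h => ?_⟩)⟩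
  rcases (mk_mem_edgesTouching.1 h).2.2 with h | h
  · exact hb (mem_of_mem_erase h)
  · exact notMem_erase r R h

lemma card_le_card_edgesTouching_of_connected (hRS : R ⊆ S)
    (hconn : (F.induce (R : Set U)).Connected) (hbd : (outerBoundary F S R).Nonempty) :
    #R ≤ #(edgesTouching F S R) := by
  obtain ⟨b, hb, r, -, hbr⟩ := exists_mem_edgesTouching_of_outerBoundary hRS hbd
  have hsub : insert s(b, r) (edgesIn F R) ⊆ edgesTouching F S R := by
    refine insert_subset hbr fun e => ?_
    induction e with | _ u v =>
    rw [mk_mem_edgesIn, mk_mem_edgesTouching]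
    exact fun ⟨huv, hu, hv⟩ => ⟨huv, ⟨hRS hu, hRS hv⟩, Or.inl hu⟩
  calc #R ≤ #(edgesIn F R) + 1 := by
        rw [← card_edgeSet_induce, ← Set.ncard_coe_finset, ← Nat.card_coe_set_eq]
        exact hconn.card_vert_le_card_edgeSet_add_one
    _ = #(insert s(b, r) (edgesIn F R)) :=
        (card_insert_of_notMem fun h => hb (mk_mem_edgesIn.1 h).2.1).symm
    _ ≤ #(edgesTouching F S R) := card_le_card hsub

end SplitWeights

section UnexpectedExtensions

open scoped Classical

variable {U V : Type*} {F : SimpleGraph U} {H : SimpleGraph V} {S R : Finset U}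
  {n : ℕ} {q : unitInterval}

lemma IsSparse.one_lt_weight (hH : IsSparse n q H) (c : F.Copy H) (hn : 2 ≤ n)
    (hR : R.Nonempty) : 1 < weight n (2 * q) F R := by
  by_cases he : #(edgesIn F R) = 0
  · rw [weight, he, pow_zero, mul_one]
    exact one_lt_pow₀ (by exact_mod_cast hn) (card_pos.2 hR).ne'
  · exact (one_lt_pow₀ one_lt_two he).trans_le (hH.two_pow_le_weight c R)

lemma IsSparse.nonempty_outerBoundary (hH : IsSparse n q H) (c : F.Copy H) (hn : 2 ≤ n)
    (hRS : R ⊆ S) (hR : R.Nonempty) (hw : relWeight n (2 * q) F S R ≤ 1) :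
    (outerBoundary F S R).Nonempty := by
  by_contra! hbd
  rw [relWeight_eq_weight hRS hbd] at hw
  exact hw.not_gt (hH.one_lt_weight c hn hR)

lemma IsSparse.card_le_card_edgesTouching (hH : IsSparse n q H) (c : F.Copy H) (hn : 2 ≤ n)
    (R : Finset U) : ∀ S, R ⊆ S → (∀ T ⊆ R, relWeight n (2 * q) F S T ≤ 1) →
      #R ≤ #(edgesTouching F S R) := by
  induction R using component_induction (F := F) with
  | empty => exact fun _ _ _ => Nat.zero_le _
  | connected R hconn =>
    intro S hRS hw
    exact card_le_card_edgesTouching_of_connected hRS hconn <|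
      hH.nonempty_outerBoundary c hn hRS (Set.nonempty_coe_sort.1 hconn.nonempty) (hw R subset_rfl)
  | union A B hAB hadj ihA ihB =>
    intro S hS hw
    obtain ⟨hAS, hBS⟩ := union_subset_iff.1 hS
    rw [card_union_of_disjoint hAB, card_edgesTouching_union]
    refine add_le_add (ihA _ (subset_sdiff.2 ⟨hAS, hAB⟩) fun T hT => ?_)
      (ihB S hBS fun T hT => hw T (hT.trans subset_union_right))
    rw [relWeight_sdiff_eq_of_not_adj hT hAB hadj]
    exact hw T (hT.trans subset_union_left)

variable [Fintype U] [Fintype V]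

lemma IsSparse.card_extensions_le_of_connected (hH : IsSparse n q H) (hn : 2 ≤ n)
    (hq : 2 * (q : ℝ) ≤ 1) (hRS : R ⊆ S) (hconn : (F.induce (R : Set U)).Connected)
    (hdeg : ∀ r ∈ R, F.degree r ≤ Real.logb 2 n) (hw : ∀ T ⊆ R, relWeight n (2 * q) F S T ≤ 1)
    (hedge : (edgesTouching F S R).Nonempty) (φ : U → V) :
    (#(extensions F H S R φ) : ℝ) ≤
      (2 * Real.exp 1 * Real.logb 2 n) ^ #(edgesTouching F S R) * Real.logb 2 n ^ #R := by
  set L := Real.logb 2 n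
  set k := #(edgesTouching F S R)
  have hL1 : 1 ≤ L := one_le_logb_two hn
  have hq0 := q.2.1
  obtain ⟨X, hYX, hXcard, hX⟩ := hH.exists_superset_weight_lt hq ((outerBoundary F S R).image φ)
  have hφ : ∀ b ∈ outerBoundary F S R, φ b ∈ X := fun b hb => hYX (mem_image_of_mem φ hb)
  have hM : (#(edgesIn H X) : ℝ) ≤ k * L := by
    refine (le_mul_logb_of_two_pow_le hXcard).trans ?_
    gcongr
    exact card_image_le.trans (card_outerBoundary_le hRS)
  have hcount := card_extensions_le_choose_mul hRS hconn.preconnected (d := ⌊L⌋₊)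
    (fun r hr => Nat.le_floor (hdeg r hr)) hedge
    (fun f hf => mem_of_forall_relWeight_le_one n.cast_nonneg (by positivity) hq hX hRS hw hf hφ) hφ
  calc (#(extensions F H S R φ) : ℝ)
      ≤ ((#(edgesIn H X)).choose k : ℝ) * ((2 * k : ℕ) * (⌊L⌋₊ : ℝ) ^ (#R - 1)) := by
        exact_mod_cast hcount
    _ ≤ (Real.exp 1 * L) ^ k * (2 ^ k * L ^ #R) := by
        gcongr
        · exact choose_le_mul_exp_pow (by positivity) hM
        · exact_mod_cast two_mul_le_two_pow (card_pos.2 hedge)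
        · calc (⌊L⌋₊ : ℝ) ^ (#R - 1) ≤ L ^ (#R - 1) := by
                gcongr
                exact Nat.floor_le (by positivity)
            _ ≤ L ^ #R := pow_le_pow_right₀ hL1 (Nat.sub_le _ _)
    _ = (2 * Real.exp 1 * L) ^ k * L ^ #R := by
        simp only [mul_pow]
        ring

lemma IsSparse.card_extensions_le_of_relWeight_le_one (hH : IsSparse n q H) (c : F.Copy H)
    (hn : 2 ≤ n) (hq : 2 * (q : ℝ) ≤ 1) (R : Finset U) : ∀ S, R ⊆ S →
    (∀ r ∈ R, F.degree r ≤ Real.logb 2 n) → (∀ T ⊆ R, relWeight n (2 * q) F S T ≤ 1) →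
    ∀ φ, (#(extensions F H S R φ) : ℝ) ≤
      (2 * Real.exp 1 * Real.logb 2 n) ^ #(edgesTouching F S R) * Real.logb 2 n ^ #R := by
  have hL1 := one_le_logb_two hn
  induction R using component_induction (F := F) with
  | empty =>
    intro S _ _ _ φ
    simpa [edgesTouching_empty] using card_extensions_empty_le (F := F) (H := H) (S := S) φ
  | connected R hconn =>
    intro S hRS hdeg hw φ
    have hR : R.Nonempty := Set.nonempty_coe_sort.1 hconn.nonempty
    refine hH.card_extensions_le_of_connected hn hq hRS hconn hdeg hw (card_pos.1 ?_) φ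
    exact (card_pos.2 hR).trans_le (hH.card_le_card_edgesTouching c hn R S hRS hw)
  | union A B hAB hadj ihA ihB =>
    intro S hS hdeg hw φ
    obtain ⟨hAS, hBS⟩ := union_subset_iff.1 hS
    have hA := ihA (S \ B) (subset_sdiff.2 ⟨hAS, hAB⟩)
      (fun r hr => hdeg r (mem_union_left B hr)) (fun T hT => by
        rw [relWeight_sdiff_eq_of_not_adj hT hAB hadj]
        exact hw T (hT.trans subset_union_left)) φ
    have hB := ihB S hBS (fun r hr => hdeg r (mem_union_right A hr))
      fun T hT => hw T (hT.trans subset_union_right)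
    refine (card_extensions_union_le φ (by positivity) hA hB).trans_eq ?_
    rw [card_edgesTouching_union, card_union_of_disjoint hAB, pow_add, pow_add]
    ring

end UnexpectedExtensions

section ExpectedExtensions

open scoped Classical

variable {U V : Type*} {F : SimpleGraph U} {H : SimpleGraph V} {S R : Finset U} {φ : U → V}
  {n : ℕ} {q : unitInterval}

lemma exists_maximal_isPacking (hR : R.Nonempty) (E : Finset (U → V)) :
    ∃ P ⊆ E, IsPacking R P ∧ ∀ f ∈ E, ∃ a ∈ R, ∃ g ∈ P, ∃ a' ∈ R, f a = g a' := by
  obtain ⟨P, hP, hmax⟩ := exists_max_image {P ∈ E.powerset | IsPacking R P} card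
    ⟨∅, mem_filter.2 ⟨empty_mem_powerset E, fun f hf => absurd hf (notMem_empty f)⟩⟩
  simp only [mem_filter, mem_powerset] at hP hmax
  refine ⟨P, hP.1, hP.2, fun f hf => ?_⟩
  by_contra! hdisj
  have hfP : f ∉ P := fun hfP => hR.elim fun r hr => hdisj r hr f hfP r hr rfl
  have hle := hmax (insert f P) ⟨insert_subset hf hP.1, ?_⟩
  · rw [card_insert_of_notMem hfP] at hle
    omega
  · intro g hg g' hg' a ha a' ha' h
    rcases mem_insert.1 hg with rfl | hgP <;> rcases mem_insert.1 hg' with rfl | hgP'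
    · rfl
    · exact absurd h (hdisj a ha g' hgP' a' ha')
    · exact absurd h.symm (hdisj a' ha' g hgP a ha)
    · exact hP.2 g hgP g' hgP' a ha a' ha' h

lemma IsSparse.card_le_card_edgesTouching_erase (hH : IsSparse n q H) (c : F.Copy H) (hn : 2 ≤ n)
    (hRS : R ⊆ S) (hw : ∀ T ⊂ R, relWeight n (2 * q) F S T ≤ 1) {r : U} (hr : r ∈ R) :
    #R ≤ #(edgesTouching F S (R.erase r)) + 1 := by
  rw [← card_erase_add_one hr]
  exact Nat.add_le_add_right (hH.card_le_card_edgesTouching c hn (R.erase r) S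
    ((erase_subset _ _).trans hRS) fun T hT => hw T (hT.trans_ssubset (erase_ssubset hr))) 1

variable [Fintype U] [Fintype V]

/-- Each extension sends some vertex of `R` to one of the at most `|R| |P|` vertices used by `P`. -/
lemma card_extensions_le_sq_mul_card_mul {P : Finset (U → V)}
    (hP : ∀ f ∈ extensions F H S R φ, ∃ a ∈ R, ∃ g ∈ P, ∃ a' ∈ R, f a = g a') {b : ℝ}
    (hb : ∀ a ∈ R, ∀ ψ, (#(extensions F H S (R.erase a) ψ) : ℝ) ≤ b) :
    (#(extensions F H S R φ) : ℝ) ≤ (#R : ℝ) ^ 2 * #P * b := by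
  have hsub : extensions F H S R φ ⊆ ((R ×ˢ P) ×ˢ R).biUnion fun x =>
      extensions F H S (R.erase x.1.1) (Function.update φ x.1.1 (x.1.2 x.2)) := by
    intro f hf
    obtain ⟨a, ha, g, hg, a', ha', h⟩ := hP f hf
    obtain ⟨hfφ, hf'⟩ := mem_extensions.1 hf
    refine mem_biUnion.2 ⟨((a, g), a'), by simp [ha, hg, ha'],
      mem_extensions.2 ⟨fun u hu => ?_, hf'⟩⟩
    obtain rfl | hua := eq_or_ne u a
    · simpa using h
    · simpa [hua] using hfφ u fun h => hu (mem_erase.2 ⟨hua, h⟩)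
  calc (#(extensions F H S R φ) : ℝ) ≤ _ :=
        Nat.cast_le.2 ((card_le_card hsub).trans card_biUnion_le)
    _ ≤ ∑ _x ∈ (R ×ˢ P) ×ˢ R, b := by
        rw [Nat.cast_sum]
        exact sum_le_sum fun x hx => hb _ (mem_product.1 (mem_product.1 hx).1).1 _
    _ = (#R : ℝ) ^ 2 * #P * b := by
        rw [sum_const, card_product, card_product, nsmul_eq_mul]
        push_cast
        ring

lemma IsSparse.card_le_of_isPacking (hH : IsSparse n q H) (hRS : R ⊆ S) (hR : R.Nonempty)
    (hedge : (edgesTouching F S R).Nonempty) {P : Finset (U → V)}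
    (hP : P ⊆ extensions F H S R φ) (hP0 : P.Nonempty) (hPack : IsPacking R P) :
    #P ≤ Real.exp 1 * relWeight n (2 * q) F S R ∨
      (outerBoundary F S R).Nonempty ∧ #P ≤ Real.logb 2 n := by
  have hq0 := q.2.1
  rw [← card_pos, ← Nat.succ_le_iff]
  refine le_exp_mul_or_le_logb (card_pos.2 hP0) (card_pos.2 hedge)
    (by rw [relWeight]; positivity) (card_outerBoundary_le hRS) ?_
  calc _ ≤ _ := mul_le_mul_of_nonneg_right (hH.factorial_card_le_of_isPacking hRS hR hP hP0 hPack)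
        (by positivity)
    _ = _ := by
        rw [relWeight_mul, relWeight, pow_mul, mul_pow (2 ^ _)]
        ring

lemma IsSparse.card_extensions_erase_le (hH : IsSparse n q H) (c : F.Copy H) (hn : 2 ≤ n)
    (hq : 2 * (q : ℝ) ≤ 1) (hRS : R ⊆ S) (hdeg : ∀ r ∈ R, F.degree r ≤ Real.logb 2 n)
    (hw : ∀ T ⊂ R, relWeight n (2 * q) F S T ≤ 1) {r : U} (hr : r ∈ R) (φ : U → V) :
    (#(extensions F H S (R.erase r) φ) : ℝ) ≤
      (2 * Real.exp 1 * Real.logb 2 n) ^ #(edgesTouching F S R) * Real.logb 2 n ^ (#R - 1) := by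
  have hL1 := one_le_logb_two hn
  have he1 := one_le_exp_one
  rw [← card_erase_of_mem hr]
  refine (hH.card_extensions_le_of_relWeight_le_one c hn hq (R.erase r) S
    ((erase_subset _ _).trans hRS) (fun r' hr' => hdeg r' (mem_of_mem_erase hr'))
    (fun T hT => hw T (hT.trans_ssubset (erase_ssubset hr))) φ).trans ?_
  gcongr
  · nlinarith
  · exact edgesTouching_mono (erase_subset _ _)

lemma IsSparse.card_mul_pow_le_of_isPacking (hH : IsSparse n q H) (c : F.Copy H) (hn : 2 ≤ n)
    (hRS : R ⊆ S) (hR : R.Nonempty) (hedge : (edgesTouching F S R).Nonempty)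
    (hcard : #R ≤ #(edgesTouching F S R) + 1) (hw : ∀ T ⊂ R, relWeight n (2 * q) F S T ≤ 1)
    (hx : 1 ≤ relWeight n (2 * q) F S R) {P : Finset (U → V)} (hP : P ⊆ extensions F H S R φ)
    (hPack : IsPacking R P) :
    #P * Real.logb 2 n ^ (#R - 1) ≤
      Real.exp 1 * relWeight n (2 * q) F S R * Real.logb 2 n ^ #(edgesTouching F S R) := by
  have hL1 := one_le_logb_two hn
  have he1 := one_le_exp_one
  rcases P.eq_empty_or_nonempty with rfl | hP0
  · rw [card_empty, Nat.cast_zero, zero_mul]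
    positivity
  set L := Real.logb 2 n
  rcases hH.card_le_of_isPacking hRS hR hedge hP hP0 hPack with hcardP | ⟨hbd, hcardP⟩
  · gcongr
    omega
  obtain ⟨r, hr, hlt⟩ := exists_card_edgesTouching_erase_lt hRS hbd
  calc #P * L ^ (#R - 1) ≤ L * L ^ (#R - 1) := by gcongr
    _ = L ^ #R := by rw [← pow_succ', Nat.sub_add_cancel (card_pos.2 hR)]
    _ ≤ L ^ #(edgesTouching F S R) := by
        gcongr
        exact (hH.card_le_card_edgesTouching_erase c hn hRS hw hr).trans hlt
    _ ≤ _ := le_mul_of_one_le_left (by positivity) (by nlinarith)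

lemma IsSparse.card_extensions_le_of_minimal (hH : IsSparse n q H) (c : F.Copy H) (hn : 2 ≤ n)
    (hq : 2 * (q : ℝ) ≤ 1) (hRS : R ⊆ S) (hR : R.Nonempty)
    (hdeg : ∀ r ∈ R, F.degree r ≤ Real.logb 2 n)
    (hw : ∀ T ⊂ R, relWeight n (2 * q) F S T ≤ 1) (hx : 1 ≤ relWeight n (2 * q) F S R) (φ : U → V) :
    (#(extensions F H S R φ) : ℝ) ≤
      relWeight n (8 * Real.exp 1 ^ 2 * Real.logb 2 n ^ 2 * (2 * q)) F S R := by
  have hcard : #R ≤ #(edgesTouching F S R) + 1 := by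
    obtain ⟨r, hr⟩ := hR
    refine (hH.card_le_card_edgesTouching_erase c hn hRS hw hr).trans ?_
    gcongr
    exact edgesTouching_mono (erase_subset _ _)
  rw [relWeight_mul]
  rcases (edgesTouching F S R).eq_empty_or_nonempty with hE | hE
  · have hR1 : #R = 1 := le_antisymm (by simpa [hE] using hcard) (card_pos.2 hR)
    rw [relWeight, hE, card_empty, pow_zero, pow_zero, one_mul, mul_one, hR1, pow_one]
    refine Nat.cast_le.2 ((card_extensions_le_pow φ).trans ?_)
    simpa [hR1] using hH.card_le
  obtain ⟨P, hP, hPack, hmax⟩ := exists_maximal_isPacking hR (extensions F H S R φ)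
  have hbound := card_extensions_le_sq_mul_card_mul hmax fun r hr ψ =>
    hH.card_extensions_erase_le c hn hq hRS hdeg hw hr ψ
  have hpacking := hH.card_mul_pow_le_of_isPacking c hn hRS hR hE hcard hw hx hP hPack
  have hL1 : 1 ≤ Real.logb 2 n := one_le_logb_two hn
  set L := Real.logb 2 n
  set X := relWeight n (2 * q) F S R
  set k := #(edgesTouching F S R)
  calc (#(extensions F H S R φ) : ℝ)
      ≤ #R ^ 2 * #P * ((2 * Real.exp 1 * L) ^ k * L ^ (#R - 1)) := hbound
    _ = #R ^ 2 * (2 * Real.exp 1 * L) ^ k * (#P * L ^ (#R - 1)) := by ring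
    _ ≤ #R ^ 2 * (2 * Real.exp 1 * L) ^ k * (Real.exp 1 * X * L ^ k) := by gcongr
    _ = #R ^ 2 * Real.exp 1 * ((2 * Real.exp 1 * L) ^ k * L ^ k * X) := by ring
    _ ≤ (4 * Real.exp 1) ^ k * ((2 * Real.exp 1 * L) ^ k * L ^ k * X) := by
        gcongr
        exact sq_mul_exp_le (card_pos.2 hE) hcard
    _ = (8 * Real.exp 1 ^ 2 * L ^ 2) ^ k * X := by
        rw [← mul_assoc, ← mul_assoc, ← mul_pow, ← mul_pow]
        ring

end ExpectedExtensions

section LogarithmicCount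

open scoped Classical

variable {U V : Type*} {F : SimpleGraph U} {H : SimpleGraph V}
  {S T T' B R : Finset U} {n : ℕ} {q : unitInterval}

lemma IsSparse.pow_card_edgesTouching_le_weight (hH : IsSparse n q H) (c : F.Copy H) {a : ℝ}
    (ha : 1 ≤ a) : a ^ #(edgesTouching F S R) ≤ weight n (a * (2 * q)) F S := by
  calc a ^ #(edgesTouching F S R) ≤ a ^ #(edgesIn F S) :=
        pow_le_pow_right₀ ha <| by rw [card_edgesIn_eq F S R]; exact Nat.le_add_left _ _
    _ ≤ a ^ #(edgesIn F S) * weight n (2 * q) F S :=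
        le_mul_of_one_le_right (by positivity) <|
          (one_le_pow₀ one_le_two).trans (hH.two_pow_le_weight c S)
    _ = weight n (a * (2 * q)) F S := (weight_mul a).symm

variable [Fintype U] [Fintype V]

lemma card_extensions_sdiff_le (hT : T ⊆ T') (hT' : T' ⊆ S) (φ : U → V) {a b : ℝ} (hb0 : 0 ≤ b)
    (ha : (#(extensions F H T' (T' \ T) φ) : ℝ) ≤ a)
    (hb : ∀ ψ, (#(extensions F H S (S \ T') ψ) : ℝ) ≤ b) :
    (#(extensions F H S (S \ T) φ) : ℝ) ≤ a * b := by
  have := card_extensions_union_le (F := F) (H := H) (S := S) (A := T' \ T) (A' := S \ T') φ hb0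
    (a := a) (by rwa [Finset.sdiff_sdiff_eq_self hT']) hb
  rwa [union_comm, sdiff_union_sdiff_cancel hT' hT] at this

/-- Add the vertices of `S \ T` in blocks, each block leading to the least possible weight. -/
lemma IsSparse.card_extensions_le_of_weight_le (hH : IsSparse n q H) (c : F.Copy H) (hn : 2 ≤ n)
    (hq0 : 0 < (q : ℝ)) (hq : 2 * (q : ℝ) ≤ 1) (hTS : T ⊆ S)
    (hdeg : ∀ r ∈ S \ T, F.degree r ≤ Real.logb 2 n)
    (hmin : ∀ T', T ⊆ T' → T' ⊆ S → weight n (2 * q) F T ≤ weight n (2 * q) F T') (φ : U → V) :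
    (#(extensions F H S (S \ T) φ) : ℝ) ≤
      relWeight n (8 * Real.exp 1 ^ 2 * Real.logb 2 n ^ 2 * (2 * q)) F S (S \ T) := by
  have hn0 : (0 : ℝ) < n := by positivity
  have hL1 := one_le_logb_two hn
  induction T using WellFoundedGT.induction generalizing φ with | ind T ih =>
  obtain rfl | hne := eq_or_ne T S
  · rw [Finset.sdiff_self, relWeight_empty]
    exact_mod_cast card_extensions_empty_le φ
  obtain ⟨T', hT', hT'min⟩ := exists_min_image (Ioc T S) (weight n (2 * q) F)
    ⟨S, right_mem_Ioc.2 (hTS.ssubset_of_ne hne)⟩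
  obtain ⟨hTT', hT'S⟩ := mem_Ioc.1 hT'
  have hblock : (#(extensions F H T' (T' \ T) φ) : ℝ) ≤ _ :=
    hH.card_extensions_le_of_minimal c hn hq sdiff_subset (sdiff_nonempty.2 hTT'.2)
      (fun r hr => hdeg r (sdiff_subset_sdiff hT'S subset_rfl hr)) (fun A hA => by
        have hAT' : A ⊆ T' := hA.1.trans sdiff_subset
        refine (relWeight_le_one_iff hn0 (by positivity) hAT').2 <|
          hT'min _ (mem_Ioc.2 ⟨?_, sdiff_subset.trans hT'S⟩)
        obtain ⟨x, hx, hxA⟩ := exists_of_ssubset hA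
        exact ⟨subset_sdiff.2 ⟨hTT'.1, disjoint_sdiff.mono_right hA.1⟩, fun h =>
          (mem_sdiff.1 hx).2 (h (mem_sdiff.2 ⟨(mem_sdiff.1 hx).1, hxA⟩))⟩)
      ((one_le_relWeight_iff hn0 (by positivity) sdiff_subset).2 <| by
        rw [Finset.sdiff_sdiff_eq_self hTT'.1]
        exact hmin T' hTT'.1 hT'S) φ
  have hrest := ih T' hTT' hT'S
    (fun r hr => hdeg r (sdiff_subset_sdiff subset_rfl hTT'.1 hr))
    (fun T'' hT'' hT''S => hT'min T'' (mem_Ioc.2 ⟨hTT'.trans_subset hT'', hT''S⟩))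
  rw [← relWeight_sdiff_mul_relWeight_sdiff hTT'.1 hT'S]
  exact card_extensions_sdiff_le hTT'.1 hT'S φ (by rw [relWeight]; positivity) hblock hrest

lemma pow_card_le_four_pow_of_logb_le_degree (hn : 2 ≤ n)
    (hB : ∀ b ∈ B, Real.logb 2 n ≤ F.degree b) : (n : ℝ) ^ #B ≤ 4 ^ #F.edgeFinset := by
  have hn0 : (0 : ℝ) < n := by positivity
  have hsum : #B * Real.logb 2 n ≤ 2 * #F.edgeFinset := by
    calc #B * Real.logb 2 n ≤ ∑ b ∈ B, (F.degree b : ℝ) := by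
          rw [← nsmul_eq_mul]
          exact card_nsmul_le_sum _ _ _ hB
      _ ≤ ∑ b, (F.degree b : ℝ) :=
          sum_le_sum_of_subset_of_nonneg (subset_univ _) fun _ _ _ => by positivity
      _ = 2 * #F.edgeFinset := by exact_mod_cast F.sum_degrees_eq_twice_card_edges
  calc (n : ℝ) ^ #B = 2 ^ (#B * Real.logb 2 n) := by
        rw [mul_comm, Real.rpow_mul (by norm_num), Real.rpow_logb (by norm_num) (by norm_num) hn0,
          Real.rpow_natCast]
    _ ≤ 2 ^ (2 * #F.edgeFinset : ℝ) := by gcongr; norm_num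
    _ = 4 ^ #F.edgeFinset := by
        rw [Real.rpow_mul (by norm_num), Real.rpow_natCast]
        norm_num

lemma IsSparse.card_extensions_sdiff_le_of_weight_le (hH : IsSparse n q H) (c : F.Copy H)
    (hn : 2 ≤ n) (hq0 : 0 < (q : ℝ)) (hq : 2 * (q : ℝ) ≤ 1) (hBT : B ⊆ T)
    (hdeg : ∀ r ∈ T \ B, F.degree r ≤ Real.logb 2 n)
    (hmin : ∀ T', B ⊆ T' → T' ⊆ T → weight n (2 * q) F T ≤ weight n (2 * q) F T') (φ : U → V) :
    (#(extensions F H T (T \ B) φ) : ℝ) ≤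
      (8 * Real.exp 1 ^ 2 * Real.logb 2 n ^ 2) ^ #(edgesTouching F T (T \ B)) := by
  have hL1 := one_le_logb_two hn
  have hw : ∀ A ⊆ T \ B, relWeight n (2 * q) F T A ≤ 1 := fun A hA =>
    (relWeight_le_one_iff (by positivity) (by positivity) (hA.trans sdiff_subset)).2 <|
      hmin _ (subset_sdiff.2 ⟨hBT, disjoint_sdiff.mono_right hA⟩) sdiff_subset
  calc (#(extensions F H T (T \ B) φ) : ℝ) ≤
        (2 * Real.exp 1 * Real.logb 2 n) ^ #(edgesTouching F T (T \ B)) *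
          Real.logb 2 n ^ #(T \ B) :=
        hH.card_extensions_le_of_relWeight_le_one c hn hq _ _ sdiff_subset hdeg hw φ
    _ ≤ (2 * Real.exp 1 * Real.logb 2 n) ^ #(edgesTouching F T (T \ B)) *
          Real.logb 2 n ^ #(edgesTouching F T (T \ B)) := by
        gcongr
        exact hH.card_le_card_edgesTouching c hn _ _ sdiff_subset hw
    _ = (2 * Real.exp 1 * Real.logb 2 n ^ 2) ^ #(edgesTouching F T (T \ B)) := by
        rw [← mul_pow]
        ring
    _ ≤ _ := by
        have := one_le_exp_one
        gcongr
        · norm_num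
        · exact le_self_pow₀ this two_ne_zero

/-- Vertices of degree larger than `log n` are few, and the others can be added in blocks. -/
lemma IsSparse.card_extensions_self_le (hH : IsSparse n q H) (c : F.Copy H) (hn : 2 ≤ n)
    (hq0 : 0 < (q : ℝ)) (hq : 2 * (q : ℝ) ≤ 1) (φ : U → V) :
    (#(extensions F H S S φ) : ℝ) ≤ 4 ^ #F.edgeFinset *
      weight n (8 * Real.exp 1 ^ 2 * Real.logb 2 n ^ 2 * (2 * q)) F S := by
  set B := {u ∈ S | Real.logb 2 n < F.degree u}
  have hBS : B ⊆ S := filter_subset _ _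
  have hdeg {T : Finset U} (hBT : B ⊆ T) : ∀ r ∈ S \ T, F.degree r ≤ Real.logb 2 n := by
    intro r hr
    by_contra! hlt
    exact (mem_sdiff.1 hr).2 (hBT (mem_filter.2 ⟨(mem_sdiff.1 hr).1, hlt⟩))
  obtain ⟨T, hT, hmin⟩ := exists_min_image (Icc B S) (weight n (2 * q) F) ⟨S, right_mem_Icc.2 hBS⟩
  obtain ⟨hBT, hTS⟩ := mem_Icc.1 hT
  have hB : (#(extensions F H B B φ) : ℝ) ≤ 4 ^ #F.edgeFinset := by
    calc (#(extensions F H B B φ) : ℝ) ≤ (Fintype.card V : ℝ) ^ #B := by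
          exact_mod_cast card_extensions_le_pow φ
      _ ≤ (n : ℝ) ^ #B := by
          have := hH.card_le
          gcongr
      _ ≤ 4 ^ #F.edgeFinset :=
          pow_card_le_four_pow_of_logb_le_degree hn fun b hb => (mem_filter.1 hb).2.le
  have hTB := hH.card_extensions_sdiff_le_of_weight_le c hn hq0 hq hBT
    (fun r hr => hdeg subset_rfl r (sdiff_subset_sdiff hTS subset_rfl hr))
    (fun T' hBT' hT' => hmin T' (mem_Icc.2 ⟨hBT', hT'.trans hTS⟩))
  have hST := hH.card_extensions_le_of_weight_le c hn hq0 hq hTS (hdeg hBT)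
    (fun T' hT' hT'S => hmin T' (mem_Icc.2 ⟨hBT.trans hT', hT'S⟩))
  have hT_edges := hH.pow_card_edgesTouching_le_weight c (S := T) (R := T \ B)
    (a := 8 * Real.exp 1 ^ 2 * Real.logb 2 n ^ 2) <| by
      have := one_le_pow₀ one_le_exp_one (n := 2)
      have := one_le_pow₀ (one_le_logb_two hn) (n := 2)
      nlinarith
  have hS := card_extensions_sdiff_le (empty_subset T) hTS φ (by rw [relWeight]; positivity)
    (card_extensions_sdiff_le (a := 4 ^ #F.edgeFinset) (empty_subset B) hBT φ (by positivity)
      (by rwa [sdiff_empty]) hTB) hST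
  rw [sdiff_empty] at hS
  calc (#(extensions F H S S φ) : ℝ) ≤ _ := hS
    _ ≤ 4 ^ #F.edgeFinset * weight n (8 * Real.exp 1 ^ 2 * Real.logb 2 n ^ 2 * (2 * q)) F T *
          relWeight n (8 * Real.exp 1 ^ 2 * Real.logb 2 n ^ 2 * (2 * q)) F S (S \ T) := by
        rw [relWeight]
        gcongr
    _ = _ := by
        rw [weight_eq_mul_relWeight (S := S) (sdiff_subset (t := T)),
          Finset.sdiff_sdiff_eq_self hTS, mul_assoc]

end LogarithmicCount

section SupportExtensions

open scoped Classical

lemma pow_le_exp_pow_mul_descFactorial {n s : ℕ} (h : s ≤ n) :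
    (n : ℝ) ^ s ≤ Real.exp 1 ^ s * n.descFactorial s := by
  have hratio : (n : ℝ) ^ s * s.descFactorial s ≤ n.descFactorial s * (s : ℝ) ^ s := by
    simp only [Nat.descFactorial_eq_prod_range, Nat.cast_prod, pow_eq_prod_const,
      ← prod_mul_distrib]
    refine prod_le_prod (fun i _ => by positivity) fun i hi => ?_
    have his : i < s := mem_range.1 hi
    have hs : (s : ℝ) ≤ n := by exact_mod_cast h
    rw [Nat.cast_sub his.le, Nat.cast_sub (his.le.trans h)]
    nlinarith [(Nat.cast_nonneg i : (0 : ℝ) ≤ i)]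
  rw [Nat.descFactorial_self] at hratio
  refine le_of_mul_le_mul_right (hratio.trans ?_) (by exact_mod_cast s.factorial_pos)
  calc (n.descFactorial s : ℝ) * (s : ℝ) ^ s
      ≤ n.descFactorial s * (Real.exp 1 ^ s * s.factorial) := by
        gcongr
        exact pow_le_exp_pow_mul_factorial s
    _ = Real.exp 1 ^ s * n.descFactorial s * s.factorial := by ring

variable {U V : Type*} [Fintype U]

lemma edgesIn_support (F : SimpleGraph U) : edgesIn F F.support.toFinset = F.edgeFinset := by
  ext e
  induction e with | _ u v =>
  rw [mk_mem_edgesIn, SimpleGraph.mem_edgeFinset, SimpleGraph.mem_edgeSet]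
  simp only [Set.mem_toFinset, SimpleGraph.mem_support]
  exact ⟨fun h => h.1, fun h => ⟨h, ⟨v, h⟩, ⟨u, h.symm⟩⟩⟩

lemma card_support_le (F : SimpleGraph U) : #F.support.toFinset ≤ 2 * #F.edgeFinset := by
  refine (card_le_card fun u hu => ?_).trans (card_biUnion_toFinset_le F.edgeFinset)
  obtain ⟨v, hv⟩ := Set.mem_toFinset.1 hu
  exact mem_biUnion.2 ⟨s(u, v), SimpleGraph.mem_edgeFinset.2 hv, by simp⟩

variable [Fintype V] {F : SimpleGraph U} {H : SimpleGraph V} {n : ℕ} {p q : unitInterval}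

lemma labelledCopyCount_eq_card_extensions (φ : U → V) :
    H.labelledCopyCount F = #(extensions F H univ univ φ) := by
  rw [labelledCopyCount_eq_card_filter, extensions]
  congr 1
  ext f
  simp [Set.injOn_univ]

lemma card_extensions_univ_compl_le (S : Finset U) (φ : U → V) :
    #(extensions F H univ Sᶜ φ) ≤
      (Fintype.card V - #S).descFactorial (Fintype.card U - #S) := by
  obtain h | ⟨f₀, hf₀⟩ := (extensions F H univ Sᶜ φ).eq_empty_or_nonempty
  · simp [h]
  have hφ {f : U → V} (hf : f ∈ extensions F H univ Sᶜ φ) : ∀ u ∈ S, f u = φ u := fun u hu =>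
    (mem_extensions.1 hf).1 u (notMem_compl.2 hu)
  have hinj {f : U → V} (hf : f ∈ extensions F H univ Sᶜ φ) : Function.Injective f := by
    simpa using (mem_extensions.1 hf).2.1
  have hcard : #(S.image φ) = #S := card_image_of_injOn fun u hu v hv h =>
    hinj hf₀ (by rw [hφ hf₀ u hu, hφ hf₀ v hv, h])
  have hemb : Fintype.card ((Sᶜ : Finset U) ↪ ((S.image φ)ᶜ : Finset V)) =
      (Fintype.card V - #S).descFactorial (Fintype.card U - #S) := by
    rw [Fintype.card_embedding_eq, Fintype.card_coe, Fintype.card_coe, card_compl, card_compl,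
      hcard]
  have hmem (f : extensions F H univ Sᶜ φ) (u : (Sᶜ : Finset U)) : f.1 u ∈ (S.image φ)ᶜ := by
    rw [mem_compl, mem_image]
    rintro ⟨v, hv, h⟩
    rw [← hφ f.2 v hv] at h
    exact mem_compl.1 u.2 (hinj f.2 h ▸ hv)
  rw [← hemb, ← Fintype.card_coe]
  refine Fintype.card_le_of_injective (fun f => ⟨fun u => ⟨f.1 u, hmem f u⟩, fun u v h =>
    Subtype.ext (hinj f.2 (congrArg Subtype.val h))⟩) fun f g h => Subtype.ext (funext fun u => ?_)
  by_cases hu : u ∈ S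
  · rw [hφ f.2 u hu, hφ g.2 u hu]
  · exact congrArg Subtype.val (DFunLike.congr_fun h ⟨u, mem_compl.2 hu⟩)

lemma labelledCopyCount_le (hV : Fintype.card V ≤ n) {r : ℝ} (hr : 0 ≤ r)
    (h : ∀ φ : U → V, (#(extensions F H F.support.toFinset F.support.toFinset φ) : ℝ) ≤
      weight n r F F.support.toFinset) :
    (H.labelledCopyCount F : ℝ) ≤
      n.descFactorial (Fintype.card U) * (Real.exp 1 ^ 2 * r) ^ #F.edgeFinset := by
  obtain h0 | hpos := Nat.eq_zero_or_pos (H.labelledCopyCount F)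
  · rw [h0, Nat.cast_zero]
    positivity
  obtain ⟨φ⟩ := SimpleGraph.labelledCopyCount_pos.1 hpos
  have hUV : Fintype.card U ≤ Fintype.card V := Fintype.card_le_of_injective φ φ.injective
  have hsupp : (n : ℝ) ^ #F.support.toFinset ≤
      (Real.exp 1 ^ 2) ^ #F.edgeFinset * n.descFactorial #F.support.toFinset := by
    refine (pow_le_exp_pow_mul_descFactorial ((card_le_univ _).trans (hUV.trans hV))).trans ?_
    rw [← pow_mul]
    gcongr
    · exact one_le_exp_one
    · exact card_support_le F
  have hchain := card_extensions_sdiff_le (F := F) (H := H) (empty_subset F.support.toFinset)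
    (subset_univ _) φ (a := weight n r F F.support.toFinset)
    (b := ((n - #F.support.toFinset).descFactorial (Fintype.card U - #F.support.toFinset)))
    (by positivity) (by rw [sdiff_empty]; exact h φ) fun ψ => by
      rw [← compl_eq_univ_sdiff]
      exact_mod_cast (card_extensions_univ_compl_le _ ψ).trans (Nat.descFactorial_le _ (by omega))
  rw [sdiff_empty, ← labelledCopyCount_eq_card_extensions, weight, edgesIn_support] at hchain
  refine hchain.trans ?_
  rw [← Nat.descFactorial_mul_descFactorial (card_le_univ F.support.toFinset), mul_pow]
  push_cast
  calc _ ≤ (Real.exp 1 ^ 2) ^ #F.edgeFinset * n.descFactorial #F.support.toFinset *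
        r ^ #F.edgeFinset *
          (n - #F.support.toFinset).descFactorial (Fintype.card U - #F.support.toFinset) := by
        gcongr
    _ = _ := by ring

lemma copyCount_lt_expectedCopies_of_card_extensions_le (hV : Fintype.card V ≤ n)
    (hU : Fintype.card U ≤ n) (hF : F.edgeSet.Nonempty) {r : ℝ} (hr : 0 ≤ r)
    (hrp : Real.exp 1 ^ 2 * r < p)
    (h : ∀ φ : U → V, (#(extensions F H F.support.toFinset F.support.toFinset φ) : ℝ) ≤
      weight n r F F.support.toFinset) :
    (H.copyCount F : ℝ) < expectedCopies n p F := by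
  refine copyCount_lt_expectedCopies ((labelledCopyCount_le hV hr h).trans_lt ?_)
  have hdesc : 0 < n.descFactorial (Fintype.card U) := Nat.descFactorial_pos.2 hU
  have hE : #F.edgeFinset ≠ 0 :=
    card_ne_zero.2 (SimpleGraph.edgeFinset_nonempty.2 (SimpleGraph.edgeSet_nonempty.1 hF))
  rw [Nat.card_eq_fintype_card, ← SimpleGraph.edgeFinset_card]
  gcongr

end SupportExtensions

section LogarithmicRegime

open scoped Classical

variable {U V : Type*} {F : SimpleGraph U} {H : SimpleGraph V} {n : ℕ}
  {p q : unitInterval}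

lemma IsSparse.pos_of_edgeSet_nonempty (hH : IsSparse n q H) (c : F.Copy H)
    (hF : F.edgeSet.Nonempty) : 0 < (q : ℝ) := by
  obtain ⟨e, he⟩ := hF
  induction e with | _ u v =>
  have hE : #(edgesIn F {u, v}) ≠ 0 :=
    card_ne_zero_of_mem (a := s(u, v)) (mk_mem_edgesIn.2 ⟨he, by simp, by simp⟩)
  refine q.2.1.lt_of_ne' fun h0 => ?_
  have := hH.one_le_weight c {u, v}
  rw [weight, h0, zero_pow hE, mul_zero] at this
  exact not_le.2 zero_lt_one this

lemma IsSparse.two_le_of_edgeSet_nonempty [Finite V] (hH : IsSparse n q H) (c : F.Copy H)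
    (hF : F.edgeSet.Nonempty) : 2 ≤ n := by
  have := Fintype.ofFinite V
  obtain ⟨e, he⟩ := hF
  induction e with | _ u v =>
  have : Nontrivial V := ⟨⟨c u, c v, fun h => F.ne_of_adj he (c.injective h)⟩⟩
  exact Fintype.one_lt_card.trans_le hH.card_le

lemma copyCount_lt_expectedCopies_of_logb_sq_le [Fintype V] (hH : IsSparse n q H) (c : F.Copy H)
    (hF : F.edgeSet.Nonempty) (hp : 128 * Real.exp 1 ^ 4 * q * Real.logb 2 n ^ 2 ≤ p) :
    (H.copyCount F : ℝ) < expectedCopies n p F := by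
  have := Fintype.ofInjective c c.injective
  have hn := hH.two_le_of_edgeSet_nonempty c hF
  have hq := hH.pos_of_edgeSet_nonempty c hF
  have hL := one_le_pow₀ (one_le_logb_two hn) (n := 2)
  have he := one_le_pow₀ one_le_exp_one (n := 4)
  have hpos : 0 < Real.exp 1 ^ 4 * q * Real.logb 2 n ^ 2 := by positivity
  refine copyCount_lt_expectedCopies_of_card_extensions_le hH.card_le
    ((Fintype.card_le_of_injective c c.injective).trans hH.card_le) hF
    (r := 4 * (8 * Real.exp 1 ^ 2 * Real.logb 2 n ^ 2 * (2 * q))) (by positivity) ?_ fun φ => ?_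
  · linarith
  · have hq2 : 2 * (q : ℝ) ≤ 1 := by
      have := le_mul_of_one_le_left hq.le he
      have := le_mul_of_one_le_right (by positivity : 0 ≤ Real.exp 1 ^ 4 * (q : ℝ)) hL
      linarith [p.2.2]
    rw [weight_mul, edgesIn_support]
    exact hH.card_extensions_self_le c hn hq hq2 φ

end LogarithmicRegime

section ComponentMaps

open scoped Classical

variable {V W : Type*} [Fintype W] {H : SimpleGraph V} {τ : SimpleGraph W} {ψ : W → V}
  {n : ℕ} {q : unitInterval}

lemma IsSparse.factorial_mul_card_aut_pow_le {ι : Type*} [Fintype ι] [Nonempty W]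
    (hH : IsSparse n q H) (c : ι → τ.Copy H) (hdisj : ∀ i j w w', c i w = c j w' → i = j) :
    ((Fintype.card ι).factorial : ℝ) * (Nat.card (τ ≃g τ) : ℝ) ^ Fintype.card ι ≤
      ((n : ℝ) ^ Fintype.card W * (q : ℝ) ^ Nat.card τ.edgeSet) ^ Fintype.card ι := by
  let T : SimpleGraph (Empty ⊕ W) := τ.comap (Equiv.emptySum Empty W)
  let e : T ≃g τ := SimpleGraph.Iso.comap (Equiv.emptySum Empty W) τ
  have hpetal := hH.factorial_mul_pow_le (T := T) (fun b => b.elim) ⟨Empty.elim, fun b => b.elim⟩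
    (fun i => (c i).comp e.toCopy) (fun _ b => b.elim) (fun i j w w' => hdisj i j w w')
  rw [Fintype.card_eq_zero (α := Empty), pow_zero, one_mul, Nat.card_congr e.mapEdgeSet] at hpetal
  have haut : Nat.card (τ ≃g τ) ≤ Nat.card (RelAut T) := by
    refine Nat.card_le_card_of_injective
      (fun g : τ ≃g τ => (⟨g.toEquiv, ?_⟩ : RelAut T)) fun g g' h => ?_
    · rintro (x | x) (y | y)
      exacts [x.elim, x.elim, y.elim, g.map_adj_iff]
    · ext w
      exact DFunLike.congr_fun (congrArg Subtype.val h) w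
  refine le_trans ?_ hpetal
  gcongr

variable [Fintype V]

/-- The bijections from `W` onto the vertex sets of connected components of `H`. -/
noncomputable def componentMaps (H : SimpleGraph V) (W : Type*) [Fintype W] : Finset (W → V) :=
  {ψ | Function.Injective ψ ∧ ∃ C : H.ConnectedComponent, Set.range ψ = C.supp}

lemma mem_componentMaps : ψ ∈ componentMaps H W ↔
    Function.Injective ψ ∧ ∃ C : H.ConnectedComponent, Set.range ψ = C.supp := by
  simp [componentMaps]

lemma connected_comap_of_mem_componentMaps (h : ψ ∈ componentMaps H W) :
    (H.comap ψ).Connected := by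
  obtain ⟨hinj, C, hC⟩ := mem_componentMaps.1 h
  have hrange : (H.induce (Set.range ψ)).Connected := by
    rw [hC]
    exact C.connected_toSimpleGraph
  exact (SimpleGraph.Embedding.comap ⟨ψ, hinj⟩ H).isoInduceRange.connected_iff.2 hrange

lemma range_eq_range_of_mem_componentMaps {ψ' : W → V} (h : ψ ∈ componentMaps H W)
    (h' : ψ' ∈ componentMaps H W) {w w' : W} (hw : ψ w = ψ' w') : Set.range ψ = Set.range ψ' := by
  obtain ⟨-, C, hC⟩ := mem_componentMaps.1 h
  obtain ⟨-, C', hC'⟩ := mem_componentMaps.1 h'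
  have hwC : ψ w ∈ C.supp := hC ▸ Set.mem_range_self w
  have hwC' : ψ' w' ∈ C'.supp := hC' ▸ Set.mem_range_self w'
  rw [SimpleGraph.ConnectedComponent.mem_supp_iff] at hwC hwC'
  rw [hC, hC', ← hwC, ← hwC', hw]

lemma card_filter_range_eq_le (C : Set V) :
    #{ψ ∈ componentMaps H W | H.comap ψ = τ ∧ Set.range ψ = C} ≤ Nat.card (τ ≃g τ) := by
  obtain h | ⟨ψ₀, hψ₀⟩ :=
    {ψ ∈ componentMaps H W | H.comap ψ = τ ∧ Set.range ψ = C}.eq_empty_or_nonempty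
  · simp [h]
  obtain ⟨hψ₀, hτ₀, hC₀⟩ := mem_filter.1 hψ₀
  have hinj₀ := (mem_componentMaps.1 hψ₀).1
  have hexists : ∀ ψ : {ψ // ψ ∈ {ψ ∈ componentMaps H W | H.comap ψ = τ ∧ Set.range ψ = C}},
      ∃ g : τ ≃g τ, ∀ w, ψ₀ (g w) = ψ.1 w := by
    rintro ⟨ψ, hψ⟩
    obtain ⟨hψ, hτ, hC⟩ := mem_filter.1 hψ
    let g : W ≃ W := (Equiv.ofInjective ψ (mem_componentMaps.1 hψ).1).trans
      ((Equiv.setCongr (hC.trans hC₀.symm)).trans (Equiv.ofInjective ψ₀ hinj₀).symm)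
    have hg : ∀ w, ψ₀ (g w) = ψ w := fun w => Equiv.apply_ofInjective_symm hinj₀ _
    refine ⟨⟨g, fun {x y} => ?_⟩, hg⟩
    conv_lhs => rw [← hτ₀]
    conv_rhs => rw [← hτ]
    rw [SimpleGraph.comap_adj, SimpleGraph.comap_adj, hg, hg]
  choose g hg using hexists
  have : Finite (τ ≃g τ) := DFunLike.finite _
  rw [← Fintype.card_coe, ← Nat.card_eq_fintype_card]
  refine Nat.card_le_card_of_injective g fun ψ ψ' h => Subtype.ext <| funext fun w => ?_
  rw [← hg, ← hg, h]

lemma IsSparse.card_filter_comap_eq_le [Nonempty W] (hH : IsSparse n q H) :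
    (#{ψ ∈ componentMaps H W | H.comap ψ = τ} : ℝ) ≤
      Real.exp 1 * ((n : ℝ) ^ Fintype.card W * (q : ℝ) ^ Nat.card τ.edgeSet) := by
  set M := {ψ ∈ componentMaps H W | H.comap ψ = τ}
  set 𝒞 := M.image Set.range
  have hfibre : #M ≤ Nat.card (τ ≃g τ) * #𝒞 :=
    card_le_mul_card_image _ _ fun C _ => by
      simpa only [M, filter_filter] using card_filter_range_eq_le C
  have hrep : ∀ C : 𝒞, ∃ ψ ∈ M, Set.range ψ = C := fun C => mem_image.1 C.2
  choose rep hrep hrange using hrep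
  simp only [M, mem_filter] at hrep
  let c (C : 𝒞) : τ.Copy H :=
    ⟨⟨rep C, fun h => by rwa [← (hrep C).2] at h⟩, (mem_componentMaps.1 (hrep C).1).1⟩
  have hsparse := hH.factorial_mul_card_aut_pow_le c fun C C' w w' hw =>
    Subtype.ext ((hrange C).symm.trans
      ((range_eq_range_of_mem_componentMaps (hrep C).1 (hrep C').1 hw).trans (hrange C')))
  rw [Fintype.card_coe] at hsparse
  have hq := q.2.1
  obtain h𝒞 | h𝒞 := eq_or_ne #𝒞 0
  · rw [h𝒞, mul_zero, Nat.le_zero] at hfibre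
    rw [hfibre, Nat.cast_zero]
    positivity
  refine (Nat.cast_le.2 hfibre).trans ?_
  rw [← pow_le_pow_iff_left₀ (by positivity) (by positivity) h𝒞, Nat.cast_mul]
  calc ((Nat.card (τ ≃g τ) : ℝ) * #𝒞) ^ #𝒞
      = (Nat.card (τ ≃g τ) : ℝ) ^ #𝒞 * (#𝒞 : ℝ) ^ #𝒞 := mul_pow ..
    _ ≤ (Nat.card (τ ≃g τ) : ℝ) ^ #𝒞 * (Real.exp 1 ^ #𝒞 * (#𝒞).factorial) := by
        gcongr
        exact pow_le_exp_pow_mul_factorial _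
    _ = Real.exp 1 ^ #𝒞 * ((#𝒞).factorial * (Nat.card (τ ≃g τ) : ℝ) ^ #𝒞) := by ring
    _ ≤ _ := by
        rw [mul_pow]
        gcongr

end ComponentMaps

section Trees

open scoped Classical

lemma exists_adj_dist_lt {V : Type*} {G : SimpleGraph V} (hG : G.Connected) {u v : V}
    (huv : u ≠ v) : ∃ w, G.Adj u w ∧ G.dist w v < G.dist u v := by
  obtain ⟨p, hp⟩ := hG.exists_walk_length_eq_dist u v
  cases p with
  | nil => exact absurd rfl huv
  | cons h p =>
    rw [SimpleGraph.Walk.length_cons] at hp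
    exact ⟨_, h, (SimpleGraph.dist_le p).trans_lt (by omega)⟩

variable {A B : Type*} [Fintype A] [Fintype B] {T : SimpleGraph A} {τ : SimpleGraph (A ⊕ B)}

lemma edgeFinset_eq_of_isTree (hT : T.Connected) (hτ : τ.IsTree) (hTτ : T ≤ τ.comap Sum.inl)
    (a₀ : A) {par : B → A ⊕ B} (hadj : ∀ i, τ.Adj (Sum.inr i) (par i))
    (hlt : ∀ i, τ.dist (par i) (Sum.inl a₀) < τ.dist (Sum.inr i) (Sum.inl a₀)) :
    T.edgeFinset.image (Sym2.map Sum.inl) ∪ univ.image (fun i => s(Sum.inr i, par i)) =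
      τ.edgeFinset := by
  refine eq_of_subset_of_card_le (union_subset ?_ ?_) ?_
  · refine image_subset_iff.2 fun e he => ?_
    induction e with | _ u v =>
    simp only [SimpleGraph.mem_edgeFinset, SimpleGraph.mem_edgeSet] at he
    simpa using hTτ he
  · simpa [subset_iff] using hadj
  have hinj : Function.Injective fun i => s(Sum.inr i, par i) := by
    intro i j hij
    obtain h | h := Sym2.eq_iff.1 hij
    · exact Sum.inr_injective h.1
    · have hi := hlt i
      rw [h.2, h.1] at hi
      exact absurd hi (hlt j).asymm
  have hdisj : Disjoint (T.edgeFinset.image (Sym2.map Sum.inl))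
      (univ.image fun i => s(Sum.inr i, par i)) := by
    rw [disjoint_left]
    rintro _ he he'
    obtain ⟨i, -, rfl⟩ := mem_image.1 he'
    obtain ⟨e, -, h⟩ := mem_image.1 he
    have hi : (Sum.inr i : A ⊕ B) ∈ Sym2.map Sum.inl e := h ▸ Sym2.mem_mk_left _ _
    simp [Sym2.mem_map] at hi
  have hTcard := hT.card_vert_le_card_edgeSet_add_one
  have hτcard := (SimpleGraph.isTree_iff_connected_and_card.1 hτ).2
  rw [card_union_of_disjoint hdisj,
    card_image_of_injective _ (Sym2.map.injective Sum.inl_injective),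
    card_image_of_injective _ hinj, card_univ]
  simp only [Nat.card_eq_fintype_card, ← SimpleGraph.edgeFinset_card, Fintype.card_sum]
    at hTcard hτcard
  omega

lemma card_trees_extending_le (hT : T.Connected) (B : Type*) [Fintype B] :
    #{τ : SimpleGraph (A ⊕ B) | τ.IsTree ∧ T ≤ τ.comap Sum.inl} ≤
      (Fintype.card A + Fintype.card B) ^ Fintype.card B := by
  obtain ⟨a₀⟩ := hT.nonempty
  have hparent (τ : SimpleGraph (A ⊕ B)) (i : B) (hτ : τ.IsTree) :=
    exists_adj_dist_lt hτ.connected (Sum.inr_ne_inl : Sum.inr i ≠ Sum.inl a₀)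
  have : Nonempty A := ⟨a₀⟩
  choose! par hadj hlt using hparent
  rw [← Fintype.card_sum, ← Fintype.card_fun, ← card_univ]
  refine card_le_card_of_injOn par (fun _ _ => mem_univ _) fun τ hτ σ hσ h => ?_
  obtain ⟨-, hτ, hTτ⟩ := mem_filter.1 hτ
  obtain ⟨-, hσ, hTσ⟩ := mem_filter.1 hσ
  rw [← SimpleGraph.edgeFinset_inj,
    ← edgeFinset_eq_of_isTree hT hτ hTτ a₀ (fun i => hadj τ i hτ) (fun i => hlt τ i hτ),
    ← edgeFinset_eq_of_isTree hT hσ hTσ a₀ (fun i => hadj σ i hσ) (fun i => hlt σ i hσ), h]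

end Trees

section TreeCopies

open scoped Classical

lemma mem_supp_of_hom {V A : Type*} {H : SimpleGraph V} {T : SimpleGraph A} (hT : T.Connected)
    (f : T →g H) (a₀ a : A) : f a ∈ (H.connectedComponentMk (f a₀)).supp := by
  rw [SimpleGraph.ConnectedComponent.mem_supp_iff, SimpleGraph.ConnectedComponent.eq]
  exact (hT.preconnected a a₀).map f

variable {V A B : Type*} {H : SimpleGraph V} {T : SimpleGraph A} {n : ℕ}
  {q : unitInterval}

lemma IsSparse.isTree_of_connected [Finite A] (hH : IsSparse n q H) (hnq : n * (q : ℝ) < 1)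
    (c : T.Copy H) (hT : T.Connected) : T.IsTree := by
  have := Fintype.ofFinite A
  have := hT.nonempty
  refine SimpleGraph.isTree_iff_connected_and_card.2
    ⟨hT, le_antisymm ?_ hT.card_vert_le_card_edgeSet_add_one⟩
  rw [Nat.card_eq_fintype_card (α := A)]
  by_contra! hlt
  have hq := q.2.1
  have haut : (1 : ℝ) ≤ Nat.card (T ≃g T) := by exact_mod_cast card_aut_pos T
  refine lt_irrefl (1 : ℝ) ?_
  calc (1 : ℝ) ≤ n ^ Fintype.card A * (q : ℝ) ^ Nat.card T.edgeSet :=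
        haut.trans (hH.card_aut_le_pow_mul c)
    _ ≤ n ^ Fintype.card A * (q : ℝ) ^ Fintype.card A := by
        gcongr ?_ * ?_
        exact pow_le_pow_of_le_one hq q.2.2 (by omega)
    _ = (n * q : ℝ) ^ Fintype.card A := (mul_pow ..).symm
    _ < 1 := pow_lt_one₀ (by positivity) hnq Fintype.card_ne_zero

variable [Fintype V] [Fintype A] [Fintype B]

lemma factorial_le_card_filter_componentMaps {C : H.ConnectedComponent} {f : A → V}
    (hf : Function.Injective f) (hfC : ∀ a, f a ∈ C.supp)
    (hC : C.supp.ncard = Fintype.card A + Fintype.card B) :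
    (Fintype.card B).factorial ≤ #{ψ ∈ componentMaps H (A ⊕ B) | ψ ∘ Sum.inl = f} := by
  have hsub : Set.range f ⊆ C.supp := Set.range_subset_iff.2 hfC
  let K : Set V := C.supp \ Set.range f
  have hK : Fintype.card B = Fintype.card K := by
    rw [← Nat.card_eq_fintype_card (α := K), Nat.card_coe_set_eq, Set.ncard_sdiff hsub, hC,
      ← Set.image_univ, Set.ncard_image_of_injective _ hf, Set.ncard_univ,
      Nat.card_eq_fintype_card, Nat.add_sub_cancel_left]
  rw [← Fintype.card_equiv (Fintype.equivOfCardEq hK), ← card_univ]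
  refine card_le_card_of_injOn (fun e : B ≃ K => Sum.elim f (Subtype.val ∘ e)) (fun e _ => ?_)
    fun e _ e' _ h => Equiv.ext fun i => Subtype.ext (congrFun h (Sum.inr i))
  refine mem_filter.2 ⟨mem_componentMaps.2 ⟨?_, C, ?_⟩, rfl⟩
  · exact hf.sumElim (Subtype.val_injective.comp e.injective) fun a i h => (e i).2.2 ⟨a, h⟩
  · rw [Set.Sum.elim_range, e.surjective.range_comp, Subtype.range_coe,
      Set.union_sdiff_cancel hsub]

/-- The injective homomorphisms from `T` to `H` that map the root `a₀` of `T` into a component of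
`H` with exactly `s` vertices. -/
noncomputable def copiesInComponents (H : SimpleGraph V) (T : SimpleGraph A) (a₀ : A) (s : ℕ) :
    Finset (A → V) :=
  {f | (Function.Injective f ∧ ∀ a b, T.Adj a b → H.Adj (f a) (f b)) ∧
    (H.connectedComponentMk (f a₀)).supp.ncard = s}

lemma mem_copiesInComponents {a₀ : A} {s : ℕ} {f : A → V} : f ∈ copiesInComponents H T a₀ s ↔
    (Function.Injective f ∧ ∀ a b, T.Adj a b → H.Adj (f a) (f b)) ∧
      (H.connectedComponentMk (f a₀)).supp.ncard = s := by
  simp [copiesInComponents]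

lemma factorial_mul_card_copiesInComponents_le (hT : T.Connected) (a₀ : A) :
    (Fintype.card B).factorial *
        #(copiesInComponents H T a₀ (Fintype.card A + Fintype.card B)) ≤
      #{ψ ∈ componentMaps H (A ⊕ B) | T ≤ (H.comap ψ).comap Sum.inl} := by
  set 𝒜 := copiesInComponents H T a₀ (Fintype.card A + Fintype.card B)
  calc (Fintype.card B).factorial * #𝒜
      ≤ ∑ f ∈ 𝒜, #{ψ ∈ componentMaps H (A ⊕ B) | ψ ∘ Sum.inl = f} := by
        rw [mul_comm, ← smul_eq_mul]
        refine card_nsmul_le_sum _ _ _ fun f hf => ?_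
        obtain ⟨⟨hinj, hhom⟩, hcard⟩ := mem_copiesInComponents.1 hf
        exact factorial_le_card_filter_componentMaps hinj
          (mem_supp_of_hom hT ⟨f, hhom _ _⟩ a₀) hcard
    _ = #(𝒜.biUnion fun f => {ψ ∈ componentMaps H (A ⊕ B) | ψ ∘ Sum.inl = f}) := by
        refine (card_biUnion fun f _ f' _ hne => disjoint_left.2 fun ψ h h' => hne ?_).symm
        exact (mem_filter.1 h).2.symm.trans (mem_filter.1 h').2
    _ ≤ _ := by
        refine card_le_card (biUnion_subset.2 fun f hf ψ hψ => ?_)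
        obtain ⟨hψH, rfl⟩ := mem_filter.1 hψ
        exact mem_filter.2 ⟨hψH, fun a b => (mem_copiesInComponents.1 hf).1.2 a b⟩

lemma IsSparse.card_filter_le_comap_le (hH : IsSparse n q H) (hnq : n * (q : ℝ) < 1)
    (hT : T.IsTree) (B : Type*) [Fintype B] :
    (#{ψ ∈ componentMaps H (A ⊕ B) | T ≤ (H.comap ψ).comap Sum.inl} : ℝ) ≤
      (Fintype.card A + Fintype.card B : ℝ) ^ Fintype.card B *
        (Real.exp 1 * ((n : ℝ) ^ (Fintype.card A + Fintype.card B) *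
          (q : ℝ) ^ (Nat.card T.edgeSet + Fintype.card B))) := by
  have : Nonempty A := hT.connected.nonempty
  set 𝒯 : Finset (SimpleGraph (A ⊕ B)) := {τ | τ.IsTree ∧ T ≤ τ.comap Sum.inl}
  have hcomap : ∀ ψ ∈ ({ψ ∈ componentMaps H (A ⊕ B) | T ≤ (H.comap ψ).comap Sum.inl} : Finset _),
      H.comap ψ ∈ 𝒯 := by
    intro ψ hψ
    obtain ⟨hψ, hTψ⟩ := mem_filter.1 hψ
    have c : (H.comap ψ).Copy H :=
      (SimpleGraph.Embedding.comap ⟨ψ, (mem_componentMaps.1 hψ).1⟩ H).toCopy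
    exact mem_filter.2 ⟨mem_univ _,
      hH.isTree_of_connected hnq c (connected_comap_of_mem_componentMaps hψ), hTψ⟩
  rw [card_eq_sum_card_fiberwise hcomap, Nat.cast_sum]
  calc _ ≤ ∑ _ ∈ 𝒯, Real.exp 1 * ((n : ℝ) ^ (Fintype.card A + Fintype.card B) *
          (q : ℝ) ^ (Nat.card T.edgeSet + Fintype.card B)) := by
        refine sum_le_sum fun τ hτ => ?_
        have hedges : Nat.card τ.edgeSet = Nat.card T.edgeSet + Fintype.card B := by
          have hTcard := (SimpleGraph.isTree_iff_connected_and_card.1 hT).2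
          have hτcard := (SimpleGraph.isTree_iff_connected_and_card.1 (mem_filter.1 hτ).2.1).2
          rw [Nat.card_sum, Nat.card_eq_fintype_card (α := B)] at hτcard
          omega
        rw [← hedges, ← Fintype.card_sum]
        refine le_trans (Nat.cast_le.2 (card_le_card ?_)) hH.card_filter_comap_eq_le
        exact filter_subset_filter _ (filter_subset _ _)
    _ ≤ _ := by
        rw [sum_const, nsmul_eq_mul]
        have hq := q.2.1
        gcongr
        exact_mod_cast card_trees_extending_le hT.connected B

lemma IsSparse.card_copiesInComponents_le (hH : IsSparse n q H) (hnq : n * (q : ℝ) < 1)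
    (hT : T.IsTree) (a₀ : A) (k : ℕ) :
    (#(copiesInComponents H T a₀ (Fintype.card A + k)) : ℝ) ≤
      Real.exp 1 ^ (Fintype.card A + 1) *
        ((n : ℝ) ^ Fintype.card A * (q : ℝ) ^ Nat.card T.edgeSet) *
        (Real.exp 1 * (n * q)) ^ k := by
  have hq := q.2.1
  have hcopies := factorial_mul_card_copiesInComponents_le (H := H) (B := Fin k) hT.connected a₀
  have hspan := hH.card_filter_le_comap_le hnq hT (Fin k)
  rw [Fintype.card_fin] at hcopies hspan
  have hexp : (Fintype.card A + k : ℝ) ^ k ≤ k.factorial * Real.exp 1 ^ (Fintype.card A + k) := by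
    have h := Real.pow_div_factorial_le_exp (Fintype.card A + k : ℝ) (by positivity) k
    rwa [div_le_iff₀ (by positivity), mul_comm, ← Nat.cast_add, ← Real.exp_one_pow,
      Nat.cast_add] at h
  refine le_of_mul_le_mul_left ?_ (by positivity : (0 : ℝ) < k.factorial)
  calc (k.factorial : ℝ) * #(copiesInComponents H T a₀ (Fintype.card A + k))
      ≤ (Fintype.card A + k : ℝ) ^ k * (Real.exp 1 * ((n : ℝ) ^ (Fintype.card A + k) *
          (q : ℝ) ^ (Nat.card T.edgeSet + k))) := le_trans (by exact_mod_cast hcopies) hspan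
    _ ≤ (k.factorial * Real.exp 1 ^ (Fintype.card A + k)) * (Real.exp 1 *
          ((n : ℝ) ^ (Fintype.card A + k) * (q : ℝ) ^ (Nat.card T.edgeSet + k))) := by gcongr
    _ = _ := by ring

lemma filter_hom_subset_biUnion_copiesInComponents (hT : T.Connected) (a₀ : A) :
    ({f | Function.Injective f ∧ ∀ a b, T.Adj a b → H.Adj (f a) (f b)} : Finset (A → V)) ⊆
      (range (Fintype.card V + 1)).biUnion fun k =>
        copiesInComponents H T a₀ (Fintype.card A + k) := by
  intro f hf
  obtain ⟨hinj, hhom⟩ := (mem_filter.1 hf).2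
  set C := H.connectedComponentMk (f a₀)
  have hAC : Fintype.card A ≤ C.supp.ncard := by
    rw [← Nat.card_eq_fintype_card, ← Set.ncard_univ, ← Set.ncard_image_of_injective _ hinj,
      Set.image_univ]
    exact Set.ncard_le_ncard (Set.range_subset_iff.2 (mem_supp_of_hom hT ⟨f, hhom _ _⟩ a₀))
  have hCV : C.supp.ncard ≤ Fintype.card V := by
    simpa using Set.ncard_le_card C.supp
  exact mem_biUnion.2 ⟨C.supp.ncard - Fintype.card A, mem_range.2 (by omega),
    mem_copiesInComponents.2 ⟨⟨hinj, hhom⟩, (Nat.add_sub_cancel' hAC).symm⟩⟩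

lemma IsSparse.labelledCopyCount_le_of_connected (hH : IsSparse n q H)
    (hnq : n * (q : ℝ) < 1 / 3) (c : T.Copy H) (hT : T.Connected) :
    (H.labelledCopyCount T : ℝ) ≤ 11 * Real.exp 1 ^ (Fintype.card A + 1) *
      ((n : ℝ) ^ Fintype.card A * (q : ℝ) ^ Nat.card T.edgeSet) := by
  obtain ⟨a₀⟩ := hT.nonempty
  have hq := q.2.1
  set x := Real.exp 1 * (n * q)
  set y := Real.exp 1 ^ (Fintype.card A + 1) *
    ((n : ℝ) ^ Fintype.card A * (q : ℝ) ^ Nat.card T.edgeSet)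
  have hx : x ≤ 10 / 11 := by
    calc Real.exp 1 * (n * q : ℝ) ≤ 2.7182818286 * (1 / 3) := by
          gcongr
          exact Real.exp_one_lt_d9.le
      _ ≤ 10 / 11 := by norm_num
  have hgeom (N : ℕ) : ∑ k ∈ range N, x ^ k ≤ 11 := by
    rw [range_eq_Ico]
    refine (geom_sum_Ico_le_of_lt_one (by positivity) (by linarith)).trans ?_
    rw [pow_zero, div_le_iff₀ (by linarith)]
    linarith
  have hsub := filter_hom_subset_biUnion_copiesInComponents (H := H) hT a₀
  rw [labelledCopyCount_eq_card_filter]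
  calc _ ≤ ((∑ k ∈ range (Fintype.card V + 1),
        #(copiesInComponents H T a₀ (Fintype.card A + k)) : ℕ) : ℝ) :=
        Nat.cast_le.2 ((card_le_card hsub).trans card_biUnion_le)
    _ ≤ ∑ k ∈ range (Fintype.card V + 1), y * x ^ k := by
        rw [Nat.cast_sum]
        refine sum_le_sum fun k _ => ?_
        exact hH.card_copiesInComponents_le (by linarith)
          (hH.isTree_of_connected (by linarith) c hT) a₀ k
    _ ≤ y * 11 := by
        rw [← mul_sum]
        gcongr
        exact hgeom _
    _ = _ := by ring

end TreeCopies

section SubcriticalRegime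

open scoped Classical

variable {U V : Type*} {F : SimpleGraph U} {H : SimpleGraph V} {S : Finset U} {n : ℕ}
  {q : unitInterval}

lemma weight_union {x y : ℝ} {A B : Finset U} (hAB : Disjoint A B)
    (hadj : ∀ a ∈ A, ∀ b ∈ B, ¬ F.Adj a b) :
    weight x y F (A ∪ B) = weight x y F A * weight x y F B := by
  have hbdry : outerBoundary F (A ∪ B) B = ∅ := by
    refine eq_empty_of_forall_notMem fun a ha => ?_
    obtain ⟨⟨haAB, haB⟩, b, hb, hab⟩ := mem_outerBoundary.1 ha
    exact hadj a ((mem_union.1 haAB).resolve_right haB) b hb hab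
  rw [weight_eq_mul_relWeight subset_union_right, relWeight_eq_weight subset_union_right hbdry,
    union_sdiff_cancel_right hAB]

variable [Fintype U] [Fintype V]

lemma card_extensions_self_le_labelledCopyCount (φ : U → V) :
    #(extensions F H S S φ) ≤ H.labelledCopyCount (F.induce (S : Set U)) := by
  rw [labelledCopyCount_eq_card_filter]
  refine card_le_card_of_injOn (fun f u => f u) (fun f hf => ?_) fun f hf g hg h => ?_
  · obtain ⟨-, hinj, hhom⟩ := mem_extensions.1 hf
    exact mem_filter.2 ⟨by simp, fun a b h => Subtype.ext (hinj a.2 b.2 h),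
      fun a b h => hhom a a.2 b b.2 h⟩
  · ext u
    by_cases hu : u ∈ S
    · exact congrFun h ⟨u, hu⟩
    · rw [(mem_extensions.1 hf).1 u hu, (mem_extensions.1 hg).1 u hu]

lemma IsSparse.card_extensions_self_le_of_connected (hH : IsSparse n q H) (c : F.Copy H)
    (hnq : n * (q : ℝ) < 1 / 3) (hS : (F.induce (S : Set U)).Connected)
    (hE : (edgesIn F S).Nonempty) (φ : U → V) :
    (#(extensions F H S S φ) : ℝ) ≤ weight n (11 * Real.exp 1 ^ 3 * q) F S := by
  have cS : (F.induce (S : Set U)).Copy H := c.comp (SimpleGraph.Embedding.induce _).toCopy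
  have htree := hH.isTree_of_connected (by linarith) cS hS
  have hcard : #(edgesIn F S) + 1 = #S := by
    have := (SimpleGraph.isTree_iff_connected_and_card.1 htree).2
    rwa [card_edgeSet_induce, Nat.card_coe_set_eq, Set.ncard_coe_finset] at this
  have hcount := hH.labelledCopyCount_le_of_connected hnq cS hS
  rw [card_edgeSet_induce, ← Nat.card_eq_fintype_card, Nat.card_coe_set_eq,
    Set.ncard_coe_finset] at hcount
  have hm := card_pos.2 hE
  set m := #(edgesIn F S)
  have hq := q.2.1
  have hconst : 11 * Real.exp 1 ^ (#S + 1) ≤ (11 * Real.exp 1 ^ 3) ^ m := by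
    rw [mul_pow, ← pow_mul]
    gcongr
    · exact le_self_pow₀ (by norm_num) hm.ne'
    · exact one_le_exp_one
    · omega
  calc (#(extensions F H S S φ) : ℝ) ≤ H.labelledCopyCount (F.induce (S : Set U)) :=
        Nat.cast_le.2 (card_extensions_self_le_labelledCopyCount φ)
    _ ≤ 11 * Real.exp 1 ^ (#S + 1) * ((n : ℝ) ^ #S * (q : ℝ) ^ m) := hcount
    _ ≤ (11 * Real.exp 1 ^ 3) ^ m * ((n : ℝ) ^ #S * (q : ℝ) ^ m) := by gcongr
    _ = weight n (11 * Real.exp 1 ^ 3 * q) F S := by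
        rw [weight, mul_pow _ (q : ℝ)]
        ring

lemma IsSparse.card_extensions_self_le_of_mul_lt_third (hH : IsSparse n q H) (c : F.Copy H)
    (hnq : n * (q : ℝ) < 1 / 3) (S : Finset U) (hS : ∀ u ∈ S, ∃ v ∈ S, F.Adj u v) (φ : U → V) :
    (#(extensions F H S S φ) : ℝ) ≤ weight n (11 * Real.exp 1 ^ 3 * q) F S := by
  have hq := q.2.1
  induction S using component_induction (F := F) generalizing φ with
  | empty =>
    have hE : edgesIn F ∅ = ∅ := by
      refine eq_empty_of_forall_notMem fun e => ?_
      induction e with | _ u v => simp [mk_mem_edgesIn]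
    rw [weight, hE, card_empty, pow_zero, card_empty, pow_zero, mul_one]
    exact_mod_cast card_extensions_empty_le φ
  | connected R hR =>
    obtain ⟨⟨u, hu⟩⟩ := hR.nonempty
    obtain ⟨v, hv, huv⟩ := hS u hu
    exact hH.card_extensions_self_le_of_connected c hnq hR
      ⟨s(u, v), mk_mem_edgesIn.2 ⟨huv, hu, hv⟩⟩ φ
  | union A B hAB hadj ihA ihB =>
    have hA : ∀ u ∈ A, ∃ v ∈ A, F.Adj u v := fun u hu => by
      obtain ⟨v, hv, huv⟩ := hS u (mem_union_left B hu)
      exact ⟨v, (mem_union.1 hv).resolve_right fun hvB => hadj u hu v hvB huv, huv⟩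
    have hB : ∀ u ∈ B, ∃ v ∈ B, F.Adj u v := fun u hu => by
      obtain ⟨v, hv, huv⟩ := hS u (mem_union_right A hu)
      exact ⟨v, (mem_union.1 hv).resolve_left fun hvA => hadj v hvA u hu huv.symm, huv⟩
    have hchain := card_extensions_sdiff_le (F := F) (H := H) (empty_subset A)
      (subset_union_left (s₂ := B)) φ (a := weight n (11 * Real.exp 1 ^ 3 * q) F A)
      (b := weight n (11 * Real.exp 1 ^ 3 * q) F B) (by rw [weight]; positivity)
      (by simpa using ihA hA φ) fun ψ => by
        rw [union_sdiff_cancel_left hAB]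
        exact (Nat.cast_le.2 (card_le_card (extensions_anti subset_union_right ψ))).trans
          (ihB hB ψ)
    rwa [sdiff_empty, ← weight_union hAB hadj] at hchain

end SubcriticalRegime

section CopyCountBounds

open scoped Classical

variable {U V : Type*} [Fintype V] {F : SimpleGraph U} {H : SimpleGraph V} {n : ℕ}
  {p q : unitInterval}

lemma copyCount_lt_expectedCopies_of_mul_lt_third (hH : IsSparse n q H) (c : F.Copy H)
    (hF : F.edgeSet.Nonempty) (hnq : n * (q : ℝ) < 1 / 3) (hp : 22 * Real.exp 1 ^ 5 * q ≤ p) :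
    (H.copyCount F : ℝ) < expectedCopies n p F := by
  have := Fintype.ofInjective c c.injective
  have hq := hH.pos_of_edgeSet_nonempty c hF
  refine copyCount_lt_expectedCopies_of_card_extensions_le hH.card_le
    ((Fintype.card_le_of_injective c c.injective).trans hH.card_le) hF
    (r := 11 * Real.exp 1 ^ 3 * q) (by positivity) ?_
    (hH.card_extensions_self_le_of_mul_lt_third c hnq _ fun u hu => ?_)
  · have : 0 < Real.exp 1 ^ 5 * (q : ℝ) := by positivity
    linarith
  · obtain ⟨v, huv⟩ := F.mem_support.1 (Set.mem_toFinset.1 hu)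
    exact ⟨v, Set.mem_toFinset.2 (F.mem_support.2 ⟨u, huv.symm⟩), huv⟩

lemma copyCount_le_expectedCopies_of_edgeSet_eq_empty [Finite U] (hV : Fintype.card V ≤ n)
    (hF : F.edgeSet = ∅) : (H.copyCount F : ℝ) ≤ expectedCopies n p F := by
  have := Fintype.ofFinite U
  refine copyCount_le_expectedCopies ?_
  have hcount : H.labelledCopyCount F ≤ n.descFactorial (Fintype.card U) := by
    rw [SimpleGraph.labelledCopyCount]
    refine (Fintype.card_le_of_injective (fun c : F.Copy H => c.toEmbedding)
      fun c c' h => SimpleGraph.Copy.ext fun u => DFunLike.congr_fun h u).trans ?_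
    rw [Fintype.card_embedding_eq]
    exact Nat.descFactorial_le _ hV
  simpa [hF] using hcount

lemma mul_lt_third_of_lt_one_div (hqn : (q : ℝ) < 1 / (3 * n)) :
    n * (q : ℝ) < 1 / 3 := by
  obtain rfl | hn := Nat.eq_zero_or_pos n
  · norm_num
  · rw [lt_div_iff₀ (by positivity)] at hqn
    linarith

lemma IsSparse.copyCount_bounds_of_lt (hH : IsSparse n q H) (F : H.Subgraph)
    (hlt : F.coe.edgeSet.Nonempty → (H.copyCount F.coe : ℝ) < expectedCopies n p F.coe) :
    (H.copyCount F.coe : ℝ) ≤ expectedCopies n p F.coe ∧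
      (F.edgeSet.Nonempty → (H.copyCount F.coe : ℝ) < expectedCopies n p F.coe) := by
  refine ⟨?_, fun hF => hlt ?_⟩
  · obtain hF | hF := F.coe.edgeSet.eq_empty_or_nonempty
    · exact copyCount_le_expectedCopies_of_edgeSet_eq_empty hH.card_le hF
    · exact (hlt hF).le
  · rw [← F.image_coe_edgeSet_coe] at hF
    exact hF.of_image

end CopyCountBounds

theorem theorem1p8 :
    (∃ K : ℝ, 0 < K ∧
      ∀ (n : ℕ) (V : Type*) [Fintype V] (H : SimpleGraph V) (p q : unitInterval),
        IsSparse n q H →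
        (p : ℝ) = K * (q : ℝ) * (Real.logb 2 (n : ℝ)) ^ 2 →
        ∀ F : H.Subgraph,
          (H.copyCount F.coe : ℝ) ≤ expectedCopies n p F.coe ∧
          (F.edgeSet.Nonempty → (H.copyCount F.coe : ℝ) < expectedCopies n p F.coe)) ∧
    (∃ α : ℝ, 0 < α ∧
      ∀ (n : ℕ) (V : Type*) [Fintype V] (H : SimpleGraph V) (p q : unitInterval),
        IsSparse n q H →
        (q : ℝ) = α * (p : ℝ) →
        (q : ℝ) < 1 / (3 * (n : ℝ)) →
        ∀ F : H.Subgraph,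
          (H.copyCount F.coe : ℝ) ≤ expectedCopies n p F.coe ∧
          (F.edgeSet.Nonempty → (H.copyCount F.coe : ℝ) < expectedCopies n p F.coe)) := by
  classical
  refine ⟨⟨128 * Real.exp 1 ^ 4, by positivity, fun n V _ H p q hH hp F => ?_⟩,
    ⟨1 / (22 * Real.exp 1 ^ 5), by positivity, fun n V _ H p q hH hqp hqn F => ?_⟩⟩
  · exact hH.copyCount_bounds_of_lt F fun hF =>
      copyCount_lt_expectedCopies_of_logb_sq_le hH F.coeCopy hF hp.ge
  · have hnq : n * (q : ℝ) < 1 / 3 := mul_lt_third_of_lt_one_div hqn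
    have hp : 22 * Real.exp 1 ^ 5 * (q : ℝ) = p := by
      rw [hqp]
      field_simp
    exact hH.copyCount_bounds_of_lt F fun hF =>
      copyCount_lt_expectedCopies_of_mul_lt_third hH F.coeCopy hF hnq hp.le
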